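/- **Setting.** Let $\Theta\subset\mathbb R^d$ be compact, let $x_1,\dots,x_n$ be data points, let $\mathcal L(\cdot,x_i)$ be real losses that are differentiable at the points of $\Theta$, and put $f_{\mathbf x}(\theta)=\frac1n\sum_{i=1}^n\mathcal L(\theta,x_i)$. Let $k$ be a kernel on $\Theta$ that is (strictly) positive definite, stationary, and four times continuously differentiable. For a finite set $D\subset\Theta$ let $$\Sigma_D(\theta)=\nabla k(\theta,\theta)\nabla^\top-\nabla k(\theta,D)\,k(D,D)^{-1}\,k(D,\theta)\nabla^\top$$ be the posterior covariance of the gradient at $\theta$ given noiseless observations on $D$. **Algorithm** (noiseless evaluations, $\sigma=0$; parameters $B,\varepsilon,\eta,\mu>0$ and $T\in\mathbb N$). Start at $\theta^{(0)}\in\Theta$ with $D_{-1}=\emptyset$. For $t=0,\dots,T-1$: 1. Let $b\ge1$ be the smallest integer such that some set $z\subset\Theta$ of $b$ points satisfies $\operatorname{Tr}\Sigma_{D_{t-1}\cup z}(\theta^{(t)})\le\varepsilon$. Choose a set $z_t\subset\Theta$ of $b$ points that minimizes $\operatorname{Tr}\Sigma_{D_{t-1}\cup z}(\theta^{(t)})$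 over all such sets $z$ of $b$ points (if the minimum is not attained, any set of $b$ points with $\operatorname{Tr}\Sigma_{D_{t-1}\cup z_t}(\theta^{(t)})\le\varepsilon$). Put $D_t=D_{t-1}\cup z_t$. 2. Let $g_t^{(i)}=\nabla k(\theta^{(t)},D_t)\,k(D_t,D_t)^{-1}\,(\mathcal L(u,x_i))_{u\in D_t}$ and $g_t=\frac1n\sum_{i=1}^n\min\{1,B/\|g_t^{(i)}\|\}\,g_t^{(i)}$. 3. Put $\theta^{(t+1)}=\theta^{(t)}-\eta\bigl(g_t+\frac{2B\sqrt T}{n\mu}w_t\bigr)$, where $w_0,\dots,w_{T-1}$ are i.i.d. $N(0,I_d)$. (If in step 1 no finite set meets the tolerance, the choice of $z_t$ is unrestricted.) **Theorem.** For all $\tau,r,B>0$ there are constants $c_1,c_2>0$, depending on $\tau$, $r$ and $B$ only, such that the following holds. Assume: * $\|\nabla f_{\mathbf x}(\theta)-\nabla f_{\mathbf x}(\theta')\|\le L\|\theta-\theta'\|$ for all $\theta,\theta'\in\Theta$, where $L>0$; * $f_{\mathbf x}$ has a local minimum $\theta^*$ with $\|\theta^{(0)}-\theta^*\|\le r$,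 the ball $B_r(\theta^*)$ is contained in $\Theta$, and $\langle\nabla f_{\mathbf x}(\theta)-\nabla f_{\mathbf x}(\theta'),\theta-\theta'\rangle\ge\tau\|\theta-\theta'\|^2$ for all $\theta,\theta'\in B_r(\theta^*)$; * $\|\nabla\mathcal L(\theta,x_i)\|\le B$ for all $i$ and all $\theta\in\Theta$; * $\mathcal L(\cdot,x_i)|_\Theta$ belongs to the reproducing kernel Hilbert space $\mathcal H$ of $k$ on $\Theta$, with $\|\mathcal L(\cdot,x_i)\|_{\mathcal H}\le C_{\mathcal X}$ for all $i$, where $C_{\mathcal X}>0$; * $0<\varepsilon\le\dfrac{\tau^2r^2}{4C_{\mathcal X}^2}$, $\;n\ge c_1\dfrac{\sqrt{T(d+\log\frac T\delta)}}{\mu}$, $\;0<\eta\le\dfrac1L$, $\;0<\delta<1$, $\;\mu>0$. Then, with probability at least $1-\delta$: all iterates $\theta^{(0)},\dots,\theta^{(T)}$ lie in $\Theta$, a set of points as required in step 1 exists at every iteration, and $F_t:=f_{\mathbf x}(\theta^{(t)})-f_{\mathbf x}(\theta^*)$ satisfies $$F_T\le(1-\eta\tau)^TF_0+\frac{\varepsilon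 C_{\mathcal X}^2}{2\tau}+\frac{\mathcal V}{\tau},\qquad \mathcal V=c_2\,\frac{\sqrt{T(d+\log\frac T\delta)}}{n\mu}.$$ -/

import Mathlib

open MeasureTheory ProbabilityTheory
open scoped Matrix

namespace DPGIBO

noncomputable section

/-- The parameter space `ℝ^d` with its Euclidean norm. -/
abbrev E (d : ℕ) : Type := EuclideanSpace ℝ (Fin d)

/-- The partial derivative `∂_i f (θ)`. -/
def partialD {d : ℕ} (i : Fin d) (f : E d → ℝ) (θ : E d) : ℝ :=
  fderiv ℝ f θ (EuclideanSpace.single i 1)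

/-! ### Kernels and the posterior of the surrogate Gaussian process -/

/-- The matrix `k(D, D)`. -/
def gram {d : ℕ} (k : E d → E d → ℝ) (D : Finset (E d)) : Matrix D D ℝ :=
  Matrix.of fun u v => k u v

/-- The `d × |D|` matrix `∇k(θ, D)` (derivatives in the first argument). -/
def gradKer {d : ℕ} (k : E d → E d → ℝ) (θ : E d) (D : Finset (E d)) : Matrix (Fin d) D ℝ :=
  Matrix.of fun i v => partialD i (fun u => k u v) θ

/-- The `|D| × d` matrix `k(D, θ)∇ᵀ` (derivatives in the second argument). -/
def kerGrad {d : ℕ} (k : E d → E d → ℝ) (D : Finset (E d)) (θ : E d) : Matrix D (Fin d) ℝ :=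
  Matrix.of fun u j => partialD j (fun v => k u v) θ

/-- The matrix `∇k(θ, θ)∇ᵀ` with entries `∂_{θ_i} ∂_{θ'_j} k(θ, θ')` at `θ' = θ`. -/
def gradKerGrad {d : ℕ} (k : E d → E d → ℝ) (θ : E d) : Matrix (Fin d) (Fin d) ℝ :=
  Matrix.of fun i j => partialD i (fun u => partialD j (fun v => k u v) θ) θ

/-- The posterior covariance `∇k_D(θ, θ)∇ᵀ` of the gradient at `θ`, given noiseless observations
at the points of `D`. -/
def postGradCov {d : ℕ} (k : E d → E d → ℝ) (D : Finset (E d)) (θ : E d) :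
    Matrix (Fin d) (Fin d) ℝ :=
  gradKerGrad k θ - gradKer k θ D * (gram k D)⁻¹ * kerGrad k D θ

open scoped Classical in
/-- The acquisition function of a batch `z`, given the evaluation set `D` and the iterate `θ`:
the trace of the posterior gradient covariance at `θ` after `z` has been added to `D`. -/
def acquisition {d : ℕ} (k : E d → E d → ℝ) (D : Finset (E d)) (θ : E d) (z : Finset (E d)) : ℝ :=
  (postGradCov k (D ∪ z) θ).trace

/-- On `Θ` the kernel `k` is (strictly) positive definite, stationary and four times continuously
differentiable: `k(u, v) = φ(u - v)` with `φ` of class `C^4` on a neighbourhood of `Θ - Θ`. -/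
structure IsGoodKernel {d : ℕ} (Θ : Set (E d)) (k : E d → E d → ℝ) : Prop where
  posDef : ∀ D : Finset (E d), (D : Set (E d)) ⊆ Θ → (gram k D).PosDef
  stationary_smooth : ∃ (φ : E d → ℝ) (U : Set (E d)), IsOpen U ∧
    (∀ u ∈ Θ, ∀ v ∈ Θ, u - v ∈ U) ∧ ContDiffOn ℝ 4 φ U ∧
    ∀ u v, u - v ∈ U → k u v = φ (u - v)

/-- The restriction of `f` to `Θ` belongs to the reproducing kernel Hilbert space of functions
on `Θ` with kernel `k`, and its norm there is at most `C`. -/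
def MemRKHSBall {d : ℕ} (Θ : Set (E d)) (k : E d → E d → ℝ) (C : ℝ) (f : E d → ℝ) : Prop :=
  ∃ (H : Type) (_ : NormedAddCommGroup H) (_ : InnerProductSpace ℝ H) (_ : CompleteSpace H)
    (_ : RKHS ℝ H Θ ℝ),
    (∀ u v : Θ, RKHS.kernel H u v 1 = k u v) ∧ ∃ g : H, (∀ θ : Θ, g θ = f θ) ∧ ‖g‖ ≤ C

/-! ### The objective -/

/-- The empirical loss `f_x(θ) = (1/n) ∑ i, ℓ(θ, x_i)`. -/
def objective {d n : ℕ} {X : Type*} (loss : E d → X → ℝ) (x : Fin n → X) (θ : E d) : ℝ :=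
  (1 / (n : ℝ)) * ∑ i, loss θ (x i)

/-- `f` has a local minimum over `Θ` at `θs`, the ball of radius `r` around `θs` lies in `Θ`, and
`f` is `τ`-strongly convex on that ball. -/
structure IsLocallyStronglyConvexMin {d : ℕ} (Θ : Set (E d)) (f : E d → ℝ) (τ r : ℝ)
    (θs : E d) : Prop where
  ball_subset : Metric.closedBall θs r ⊆ Θ
  localMin : IsLocalMinOn f Θ θs
  strongConvex : ∀ θ ∈ Metric.closedBall θs r, ∀ θ' ∈ Metric.closedBall θs r,
    τ * ‖θ - θ'‖ ^ 2 ≤ inner ℝ (gradient f θ - gradient f θ') (θ - θ')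

/-! ### The algorithm (noiseless evaluations) -/

/-- Clipping to norm at most `B`. -/
def clip {d : ℕ} (B : ℝ) (g : E d) : E d := min 1 (B / ‖g‖) • g

/-- The surrogate posterior mean gradient `∇k(θ, D) k(D, D)⁻¹ y`, where `y` is the vector of the
evaluations of `h` at the points of `D`. -/
def surrogateGrad {d : ℕ} (k : E d → E d → ℝ) (D : Finset (E d)) (h : E d → ℝ) (θ : E d) : E d :=
  WithLp.toLp 2 (gradKer k θ D *ᵥ ((gram k D)⁻¹ *ᵥ fun u : D => h u))

/-- The aggregated clipped gradient `g_t`. -/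
def clippedGrad {d n : ℕ} {X : Type*} (k : E d → E d → ℝ) (loss : E d → X → ℝ) (x : Fin n → X)
    (B : ℝ) (D : Finset (E d)) (θ : E d) : E d :=
  (1 / (n : ℝ)) • ∑ i, clip B (surrogateGrad k D (fun u => loss u (x i)) θ)

/-- `z` is a batch that the algorithm may query at the iterate `θ` with evaluation set `D`.
Its size is the least `b ≥ 1` for which some `b` points of `Θ` bring the acquisition function to
at most `ε`; it does so itself; and it minimizes the acquisition function among all sets of `b`
points of `Θ` whenever this minimum is attained. -/
structure IsBatch {d : ℕ} (Θ : Set (E d)) (k : E d → E d → ℝ) (ε : ℝ) (D : Finset (E d))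
    (θ : E d) (z : Finset (E d)) : Prop where
  subset : (z : Set (E d)) ⊆ Θ
  card_pos : 0 < z.card
  le_tol : acquisition k D θ z ≤ ε
  card_min : ∀ z' : Finset (E d), (z' : Set (E d)) ⊆ Θ → 0 < z'.card →
    acquisition k D θ z' ≤ ε → z.card ≤ z'.card
  argmin : (∃ z₀ ∈ {z' : Finset (E d) | (z' : Set (E d)) ⊆ Θ ∧ z'.card = z.card},
      IsMinOn (acquisition k D θ) {z' | (z' : Set (E d)) ⊆ Θ ∧ z'.card = z.card} z₀) →
    IsMinOn (acquisition k D θ) {z' | (z' : Set (E d)) ⊆ Θ ∧ z'.card = z.card} z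

open scoped Classical in
/-- The set of the points queried before step `t`, so `evalSet z t` is the evaluation set at the
start of step `t`, and `evalSet z (t + 1)` the one after the batch `z t` has been added. -/
def evalSet {d : ℕ} (z : ℕ → Finset (E d)) (t : ℕ) : Finset (E d) :=
  (Finset.range t).biUnion z

/-- `θ 0, …, θ T` and `z 0, …, z (T - 1)` are the iterates and the batches of one run of the
algorithm started at `θ₀`, when `w 0, …, w (T - 1)` are the values of the privacy noise.
If at some step there is no set of points that meets the tolerance, nothing is required of the
batch of that step. -/
structure IsRun {d n : ℕ} {X : Type*} (Θ : Set (E d)) (k : E d → E d → ℝ) (loss : E d → X → ℝ)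
    (x : Fin n → X) (B ε η μ : ℝ) (T : ℕ) (θ₀ : E d) (w θ : ℕ → E d) (z : ℕ → Finset (E d)) :
    Prop where
  init : θ 0 = θ₀
  batch : ∀ t < T, (∃ z', IsBatch Θ k ε (evalSet z t) (θ t) z') →
    IsBatch Θ k ε (evalSet z t) (θ t) (z t)
  step : ∀ t < T, θ (t + 1) = θ t - η • (clippedGrad k loss x B (evalSet z (t + 1)) (θ t) +
    (2 * B * √T / (n * μ)) • w t)

end

end DPGIBO

/-! Each update is a gradient step on `f` with an error `e` made of the surrogate bias and the
privacy noise. As long as `‖e‖ ≤ (3/4) τ r`, the iterate cannot leave the ball around the minimizer.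
There the quadratic upper bound and the Polyak–Łojasiewicz inequality give `F⁺ ≤ (1 - ητ) F + (η/2)
‖e‖²`, whose fixed point is `‖e‖² / (2τ)` (`inexact_gradStep`). Since `f` is controlled only on a
ball, co-coercivity of the gradient holds only where its test points stay inside; the contraction is
therefore proved near interior points and integrated along a radius (`norm_gradStep_sub_center_le`).

Bias: the error of a surrogate partial derivative is a limit of inner products of the RKHS function
with vectors whose squared norms tend to the posterior variance, so Cauchy–Schwarz bounds the
gradient error by `C √ε` (`norm_gradient_sub_surrogateGrad_sq_le`). Clipping projects onto a ball
containing the true gradients and does not enlarge this. A batch meeting the tolerance exists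
because two nearby points reveal a difference quotient (`exists_isBatch`).

Noise: a Gaussian tail and a union bound control all steps at once (`exists_noise_event`). On that
event the rest is a deterministic induction, `IsRun.invariant`. -/

namespace DPGIBO

open Filter Topology Set

/-! ### Inexact gradient descent on a ball of strong convexity. -/

section Optimization

theorem sub_le_of_hasDerivAt_le {g g' : ℝ → ℝ} {a c : ℝ}
    (hg : ∀ t ∈ Icc (0 : ℝ) 1, HasDerivAt g (g' t) t)
    (hle : ∀ t ∈ Icc (0 : ℝ) 1, g' t ≤ a + c * t) : g 1 - g 0 ≤ a + c / 2 := by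
  have hd : ∀ t ∈ Icc (0 : ℝ) 1,
      HasDerivAt (fun t => g t - (a * t + c / 2 * t ^ 2)) (g' t - (a + c * t)) t := by
    intro t ht
    have h := (hg t ht).sub (((hasDerivAt_id t).const_mul a).add
      (((hasDerivAt_id t).pow 2).const_mul (c / 2)))
    refine h.congr_deriv ?_
    simp
    ring
  have hanti : AntitoneOn (fun t => g t - (a * t + c / 2 * t ^ 2)) (Icc 0 1) := by
    refine antitoneOn_of_hasDerivWithinAt_nonpos (convex_Icc 0 1)
      (fun t ht => (hd t ht).continuousAt.continuousWithinAt)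
      (fun t ht => (hd t (interior_subset ht)).hasDerivWithinAt)
      (fun t ht => sub_nonpos.2 (hle t (interior_subset ht)))
  have h := hanti (left_mem_Icc.2 zero_le_one) (right_mem_Icc.2 zero_le_one) zero_le_one
  simp at h
  linarith

variable {F : Type*} [NormedAddCommGroup F] [InnerProductSpace ℝ F] [CompleteSpace F]

theorem hasDerivAt_comp_segment {f : F → ℝ} {x v : F} {t : ℝ}
    (hf : DifferentiableAt ℝ f (x + t • v)) :
    HasDerivAt (fun s : ℝ => f (x + s • v)) (inner ℝ (gradient f (x + t • v)) v) t := by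
  have h1 : HasDerivAt (fun s : ℝ => x + s • v) v t := by
    simpa using ((hasDerivAt_id t).smul_const v).const_add x
  have h2 := hf.hasGradientAt.hasFDerivAt.comp_hasDerivAt t h1
  exact h2

/-- Quadratic upper and lower bounds for a function whose gradient is Lipschitz and strongly
monotone on a convex set. -/
theorem bregman_bounds {f : F → ℝ} {S : Set F} {L τ : ℝ} (hS : Convex ℝ S)
    (hd : ∀ u ∈ S, DifferentiableAt ℝ f u)
    (hL : ∀ u ∈ S, ∀ v ∈ S, ‖gradient f u - gradient f v‖ ≤ L * ‖u - v‖)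
    (hτ : ∀ u ∈ S, ∀ v ∈ S, τ * ‖u - v‖ ^ 2 ≤ inner ℝ (gradient f u - gradient f v) (u - v))
    {x y : F} (hx : x ∈ S) (hy : y ∈ S) :
    τ / 2 * ‖y - x‖ ^ 2 ≤ f y - f x - inner ℝ (gradient f x) (y - x) ∧
      f y - f x - inner ℝ (gradient f x) (y - x) ≤ L / 2 * ‖y - x‖ ^ 2 := by
  set v := y - x with hv
  have hmem : ∀ t ∈ Icc (0 : ℝ) 1, x + t • v ∈ S := fun t ht =>
    hS.add_smul_sub_mem hx hy ht
  have hder : ∀ t ∈ Icc (0 : ℝ) 1, HasDerivAt (fun s : ℝ => f (x + s • v))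
      (inner ℝ (gradient f (x + t • v)) v) t := fun t ht =>
    hasDerivAt_comp_segment (hd _ (hmem t ht))
  have hxy : x + v = y := by simp [hv]
  constructor
  · have h := sub_le_of_hasDerivAt_le (g := fun s : ℝ => -f (x + s • v))
      (g' := fun t => -inner ℝ (gradient f (x + t • v)) v) (a := -inner ℝ (gradient f x) v)
      (c := -(τ * ‖v‖ ^ 2)) (fun t ht => (hder t ht).neg) ?_
    · simp only [hxy, one_smul, zero_smul, add_zero] at h
      linarith
    · intro t ht
      rcases ht.1.eq_or_lt with h0 | h0
      · simp [← h0]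
      have h := hτ _ (hmem t ht) x hx
      simp only [add_sub_cancel_left, norm_smul, Real.norm_eq_abs, mul_pow, sq_abs,
        inner_smul_right, inner_sub_left] at h
      have h' : t * (τ * t * ‖v‖ ^ 2) ≤
          t * (inner ℝ (gradient f (x + t • v)) v - inner ℝ (gradient f x) v) := by
        linarith
      have := le_of_mul_le_mul_left h' h0
      linarith
  · have h := sub_le_of_hasDerivAt_le (a := inner ℝ (gradient f x) v) (c := L * ‖v‖ ^ 2) hder ?_
    · simp only [hxy, one_smul, zero_smul, add_zero] at h
      linarith
    · intro t ht
      have h1 := real_inner_le_norm (gradient f (x + t • v) - gradient f x) v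
      have h2 := hL _ (hmem t ht) x hx
      simp only [add_sub_cancel_left, norm_smul, Real.norm_eq_abs, abs_of_nonneg ht.1] at h2
      rw [inner_sub_left] at h1
      have h3 := mul_le_mul_of_nonneg_right h2 (norm_nonneg v)
      linarith

omit [CompleteSpace F] in
-- One half of co-coercivity: compare the convexity bound from `x` and the smoothness bound from `y`
-- at the point `y - M⁻¹ (γ y - γ x)`. The bounds are assumed at this single point, so it suffices
-- to know that it lies in the domain.
theorem norm_sub_sq_le_bregman {h : F → ℝ} {γ : F → F} {M : ℝ} (hM : 0 < M) {x y : F}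
    (hlow : 0 ≤ h (y - M⁻¹ • (γ y - γ x)) - h x - inner ℝ (γ x) (y - M⁻¹ • (γ y - γ x) - x))
    (hup : h (y - M⁻¹ • (γ y - γ x)) - h y - inner ℝ (γ y) (y - M⁻¹ • (γ y - γ x) - y) ≤
      M / 2 * ‖y - M⁻¹ • (γ y - γ x) - y‖ ^ 2) :
    ‖γ y - γ x‖ ^ 2 ≤ 2 * M * (h y - h x - inner ℝ (γ x) (y - x)) := by
  set D := γ y - γ x with hD
  have e1 : y - M⁻¹ • D - y = -(M⁻¹ • D) := by abel
  have e2 : y - M⁻¹ • D - x = (y - x) - M⁻¹ • D := by abel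
  rw [e1, norm_neg, norm_smul, inner_neg_right, inner_smul_right, Real.norm_eq_abs, mul_pow,
    sq_abs] at hup
  rw [e2, inner_sub_right, inner_smul_right] at hlow
  have e3 : inner ℝ (γ y) D - inner ℝ (γ x) D = ‖D‖ ^ 2 := by
    rw [← inner_sub_left, ← hD, real_inner_self_eq_norm_sq]
  have e4 : M / 2 * (M⁻¹ ^ 2 * ‖D‖ ^ 2) = M⁻¹ * ‖D‖ ^ 2 / 2 := by
    field_simp
  have e5 : M⁻¹ * inner ℝ (γ y) D - M⁻¹ * inner ℝ (γ x) D = M⁻¹ * ‖D‖ ^ 2 := by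
    rw [← e3]; ring
  have h6 : M⁻¹ * ‖D‖ ^ 2 / 2 ≤ h y - h x - inner ℝ (γ x) (y - x) := by
    linarith
  have h7 := mul_le_mul_of_nonneg_left h6 (by positivity : 0 ≤ 2 * M)
  have e8 : 2 * M * (M⁻¹ * ‖D‖ ^ 2 / 2) = ‖D‖ ^ 2 := by field_simp
  linarith

omit [CompleteSpace F] in
-- Here `D` stands for the gradient difference of `f - (τ/2)‖·‖²`. After expanding the square,
-- co-coercivity absorbs `η² ‖D‖²` into the cross term.
theorem norm_gradStep_sub_le {η τ M : ℝ} {v D : F} (hη : 0 < η) (hM : 0 ≤ M)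
    (h1 : η * τ ≤ 1) (h2 : η * (M + 2 * τ) ≤ 2) (hco : ‖D‖ ^ 2 ≤ M * inner ℝ D v) :
    ‖(1 - η * τ) • v - η • D‖ ≤ (1 - η * τ) * ‖v‖ := by
  have hκ : 0 ≤ 1 - η * τ := by linarith
  refine le_of_sq_le_sq ?_ (by positivity)
  rw [norm_sub_sq_real, norm_smul, norm_smul, Real.norm_of_nonneg hκ, Real.norm_of_nonneg hη.le,
    inner_smul_left, inner_smul_right, real_inner_comm]
  simp only [conj_trivial]
  rcases hM.eq_or_lt with h0 | h0
  · subst h0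
    have : ‖D‖ = 0 := by nlinarith [norm_nonneg D]
    have hD : D = 0 := norm_eq_zero.1 this
    simp [hD]
  have hi : 0 ≤ inner ℝ D v := by
    by_contra hneg
    push Not at hneg
    nlinarith [sq_nonneg ‖D‖]
  have h3 := mul_le_mul_of_nonneg_left hco (by positivity : 0 ≤ η ^ 2)
  have h4 : η * inner ℝ D v * (η * (M + 2 * τ)) ≤ η * inner ℝ D v * 2 :=
    mul_le_mul_of_nonneg_left h2 (by positivity)
  nlinarith

/-- Around a point of an open set, a gradient step contracts distances to that point. -/
theorem eventually_norm_gradStep_sub_le {f : F → ℝ} {S : Set F} {L τ τ' η : ℝ}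
    (hS : Convex ℝ S)
    (hd : ∀ u ∈ S, DifferentiableAt ℝ f u)
    (hL : ∀ u ∈ S, ∀ v ∈ S, ‖gradient f u - gradient f v‖ ≤ L * ‖u - v‖)
    (hτ : ∀ u ∈ S, ∀ v ∈ S, τ * ‖u - v‖ ^ 2 ≤ inner ℝ (gradient f u - gradient f v) (u - v))
    (hlt : τ' < τ) (hτL : τ ≤ L) (hη : 0 < η) (hηL : η * L ≤ 1)
    {p : F} (hp : S ∈ 𝓝 p) :
    ∀ᶠ y in 𝓝 p, ‖(y - η • gradient f y) - (p - η • gradient f p)‖ ≤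
      (1 - η * τ') * ‖y - p‖ := by
  have hpS : p ∈ S := mem_of_mem_nhds hp
  have hM : 0 < L - τ' := by linarith
  have hcont : ContinuousAt (gradient f) p := by
    rw [ContinuousAt, tendsto_iff_norm_sub_tendsto_zero]
    refine squeeze_zero' (Eventually.of_forall fun _ => norm_nonneg _) (g := fun y => L * ‖y - p‖)
      (by filter_upwards [hp] with y hy using hL y hy p hpS) ?_
    have : ContinuousAt (fun y => L * ‖y - p‖) p := by fun_prop
    simpa [ContinuousAt] using this
  -- Removing the quadratic leaves convexity and smoothness with constant `L - τ'`, which is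
  -- positive even when `L = τ` because `τ' < τ`.
  set h : F → ℝ := fun u => f u - τ' / 2 * ‖u‖ ^ 2 with hh
  set γ : F → F := fun u => gradient f u - τ' • u with hγ
  have hγc : ContinuousAt γ p := hcont.sub (continuousAt_id.const_smul τ')
  have hbr : ∀ x y : F, h y - h x - inner ℝ (γ x) (y - x) =
      f y - f x - inner ℝ (gradient f x) (y - x) - τ' / 2 * ‖y - x‖ ^ 2 := by
    intro x y
    simp only [hh, hγ, inner_sub_left, inner_sub_right, inner_smul_left, norm_sub_sq_real,
      real_inner_self_eq_norm_sq, conj_trivial, real_inner_comm]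
    ring
  have hlow : ∀ x ∈ S, ∀ y ∈ S, 0 ≤ h y - h x - inner ℝ (γ x) (y - x) := by
    intro x hx y hy
    rw [hbr]
    nlinarith [(bregman_bounds hS hd hL hτ hx hy).1, sq_nonneg ‖y - x‖]
  have hup : ∀ x ∈ S, ∀ y ∈ S, h y - h x - inner ℝ (γ x) (y - x) ≤
      (L - τ') / 2 * ‖y - x‖ ^ 2 := by
    intro x hx y hy
    rw [hbr]
    nlinarith [(bregman_bounds hS hd hL hτ hx hy).2, sq_nonneg ‖y - x‖]
  have ht1 : Tendsto (fun y => y - (L - τ')⁻¹ • (γ y - γ p)) (𝓝 p) (𝓝 p) := by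
    have : ContinuousAt (fun y => y - (L - τ')⁻¹ • (γ y - γ p)) p :=
      continuousAt_id.sub ((hγc.sub continuousAt_const).const_smul _)
    simpa [ContinuousAt] using this
  have ht2 : Tendsto (fun y => p - (L - τ')⁻¹ • (γ p - γ y)) (𝓝 p) (𝓝 p) := by
    have : ContinuousAt (fun y => p - (L - τ')⁻¹ • (γ p - γ y)) p :=
      continuousAt_const.sub ((continuousAt_const.sub hγc).const_smul _)
    simpa [ContinuousAt] using this
  -- Both co-coercivity test points tend to `p`, hence lie in `S` for `y` near `p`; adding the two
  -- halves gives full co-coercivity.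
  filter_upwards [hp, ht1 hp, ht2 hp] with y hy h1 h2
  have hA := norm_sub_sq_le_bregman hM (hlow p hpS _ h1) (hup y hy _ h1)
  have hB := norm_sub_sq_le_bregman hM (hlow y hy _ h2) (hup p hpS _ h2)
  have hco : ‖γ y - γ p‖ ^ 2 ≤ (L - τ') * inner ℝ (γ y - γ p) (y - p) := by
    rw [norm_sub_rev (γ p)] at hB
    have : inner ℝ (γ y - γ p) (y - p) = (h y - h p - inner ℝ (γ p) (y - p)) +
        (h p - h y - inner ℝ (γ y) (p - y)) := by
      rw [← neg_sub y p, inner_neg_right, inner_sub_left]; ring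
    rw [this]
    linarith
  have hstep := norm_gradStep_sub_le (τ := τ') hη hM.le (by nlinarith) (by nlinarith) hco
  convert hstep using 2
  simp only [hγ]
  module

/-- Along the radius from `p` to `x` the local contraction bounds the growth rate of `‖G (p + t v) -
G p‖` by `(1 - ητ')‖v‖`. Points with `t < 1` are interior; a boundary point `x` is reached by
continuity. -/
theorem norm_gradStep_sub_center_le {f : F → ℝ} {p x : F} {r L τ τ' η : ℝ} (hr : 0 < r)
    (hd : ∀ u ∈ Metric.closedBall p r, DifferentiableAt ℝ f u)
    (hL : ∀ u ∈ Metric.closedBall p r, ∀ v ∈ Metric.closedBall p r,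
      ‖gradient f u - gradient f v‖ ≤ L * ‖u - v‖)
    (hτ : ∀ u ∈ Metric.closedBall p r, ∀ v ∈ Metric.closedBall p r,
      τ * ‖u - v‖ ^ 2 ≤ inner ℝ (gradient f u - gradient f v) (u - v))
    (hτ0 : 0 < τ) (hlt : τ' < τ) (hτL : τ ≤ L) (hη : 0 < η) (hηL : η * L ≤ 1)
    (hx : x ∈ Metric.closedBall p r) :
    ‖(x - η • gradient f x) - (p - η • gradient f p)‖ ≤ (1 - η * τ') * ‖x - p‖ := by
  set v := x - p with hv
  have hvr : ‖v‖ ≤ r := mem_closedBall_iff_norm.1 hx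
  have hp : p ∈ Metric.closedBall p r := Metric.mem_closedBall_self hr.le
  have hmem : ∀ t ∈ Icc (0 : ℝ) 1, p + t • v ∈ Metric.closedBall p r := fun t ht =>
    (convex_closedBall p r).add_smul_sub_mem hp hx ht
  set G : F → F := fun y => y - η • gradient f y with hG
  have hgc : ContinuousOn (gradient f) (Metric.closedBall p r) := by
    have : LipschitzOnWith (Real.toNNReal L) (gradient f) (Metric.closedBall p r) := by
      refine LipschitzOnWith.of_dist_le_mul fun u hu w hw => ?_
      rw [dist_eq_norm, dist_eq_norm, Real.coe_toNNReal _ (by linarith)]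
      exact hL u hu w hw
    exact this.continuousOn
  have hGc : ContinuousOn G (Metric.closedBall p r) := continuousOn_id.sub (hgc.const_smul η)
  have hseg : ContinuousOn (fun t : ℝ => G (p + t • v) - G p) (Icc 0 1) :=
    (hGc.comp (by fun_prop : Continuous fun t : ℝ => p + t • v).continuousOn hmem).sub
      continuousOn_const
  have hfin := image_le_of_liminf_slope_right_le_deriv_boundary
    (f := fun t : ℝ => ‖G (p + t • v) - G p‖) (a := 0) (b := 1)
    (B := fun t => ((1 - η * τ') * ‖v‖) * t) (B' := fun _ => (1 - η * τ') * ‖v‖)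
    hseg.norm (by simp) (by fun_prop)
    (fun t _ => by simpa using ((hasDerivAt_id t).const_mul ((1 - η * τ') * ‖v‖)).hasDerivWithinAt)
    ?_ (right_mem_Icc.2 zero_le_one)
  · simpa [hv, hG] using hfin
  · intro t ht b hb
    have hnhds : Metric.closedBall p r ∈ 𝓝 (p + t • v) := by
      refine Metric.closedBall_mem_nhds_of_mem ?_
      rw [mem_ball_iff_norm, add_sub_cancel_left, norm_smul, Real.norm_of_nonneg ht.1]
      nlinarith [ht.1, ht.2]
    have hev := eventually_norm_gradStep_sub_le (convex_closedBall p r) hd hL hτ hlt hτL hη hηL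
      hnhds
    have htend : Tendsto (fun s : ℝ => p + s • v) (𝓝[>] t) (𝓝 (p + t • v)) :=
      ((by fun_prop : Continuous fun s : ℝ => p + s • v).tendsto t).mono_left nhdsWithin_le_nhds
    refine Eventually.frequently ?_
    filter_upwards [htend.eventually hev, self_mem_nhdsWithin] with s hs hts
    have hts' : 0 < s - t := sub_pos.2 hts
    refine lt_of_le_of_lt ?_ hb
    rw [slope_def_field, div_le_iff₀ hts']
    have e : p + s • v - (p + t • v) = (s - t) • v := by module
    rw [e, norm_smul, Real.norm_of_nonneg hts'.le] at hs
    have h3 := norm_sub_norm_le (G (p + s • v) - G p) (G (p + t • v) - G p)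
    rw [sub_sub_sub_cancel_right] at h3
    calc _ ≤ _ := h3
      _ ≤ _ := hs
      _ = _ := by ring

/-- One inexact gradient step started in the ball around the minimizer on which the function is
strongly convex: it stays in the ball and decreases the suboptimality gap. -/
theorem inexact_gradStep {f : F → ℝ} {p x e : F} {r L τ τ' η ρ : ℝ} (hr : 0 < r)
    (hd : ∀ u ∈ Metric.closedBall p r, DifferentiableAt ℝ f u)
    (hL : ∀ u ∈ Metric.closedBall p r, ∀ v ∈ Metric.closedBall p r,
      ‖gradient f u - gradient f v‖ ≤ L * ‖u - v‖)
    (hτ : ∀ u ∈ Metric.closedBall p r, ∀ v ∈ Metric.closedBall p r,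
      τ * ‖u - v‖ ^ 2 ≤ inner ℝ (gradient f u - gradient f v) (u - v))
    (hτ0 : 0 < τ) (hlt : τ' < τ) (hτL : τ ≤ L) (hη : 0 < η) (hηL : η * L ≤ 1)
    (hgrad : gradient f p = 0)
    (hx : x ∈ Metric.closedBall p r) (he : ‖e‖ ≤ ρ) (hρ : ρ ≤ τ' * r) :
    x - η • (gradient f x + e) ∈ Metric.closedBall p r ∧
      f (x - η • (gradient f x + e)) - f p ≤ (1 - η * τ) * (f x - f p) + η / 2 * ρ ^ 2 := by
  have hp : p ∈ Metric.closedBall p r := Metric.mem_closedBall_self hr.le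
  have hxr : ‖x - p‖ ≤ r := mem_closedBall_iff_norm.1 hx
  have hmem : x - η • (gradient f x + e) ∈ Metric.closedBall p r := by
    rw [mem_closedBall_iff_norm]
    have h1 := norm_gradStep_sub_center_le hr hd hL hτ hτ0 hlt hτL hη hηL hx
    rw [hgrad, smul_zero, sub_zero] at h1
    have e1 : x - η • (gradient f x + e) - p = (x - η • gradient f x - p) - η • e := by module
    have h2 := norm_sub_le (x - η • gradient f x - p) (η • e)
    rw [norm_smul, Real.norm_of_nonneg hη.le] at h2
    rw [e1]
    have h3 : (1 - η * τ') * ‖x - p‖ ≤ (1 - η * τ') * r :=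
      mul_le_mul_of_nonneg_left hxr (by nlinarith)
    have h4 : η * ‖e‖ ≤ η * (τ' * r) := mul_le_mul_of_nonneg_left (he.trans hρ) hη.le
    linarith
  refine ⟨hmem, ?_⟩
  set g := gradient f x with hg
  have hup := (bregman_bounds (convex_closedBall p r) hd hL hτ hx hmem).2
  have hlow := (bregman_bounds (convex_closedBall p r) hd hL hτ hx hp).1
  rw [← hg] at hup hlow
  have e1 : x - η • (g + e) - x = -(η • (g + e)) := by abel
  rw [e1, norm_neg, norm_smul, Real.norm_of_nonneg hη.le, inner_neg_right, inner_smul_right,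
    inner_add_right, real_inner_self_eq_norm_sq, mul_pow, norm_add_sq_real] at hup
  -- Polyak–Łojasiewicz: complete the square in the strong convexity bound at `p`.
  have hPL : 2 * τ * (f x - f p) ≤ ‖g‖ ^ 2 := by
    have h1 : -inner ℝ g (p - x) ≤ ‖g‖ * ‖p - x‖ :=
      (neg_le_abs _).trans (abs_real_inner_le_norm _ _)
    nlinarith [sq_nonneg (‖g‖ - τ * ‖p - x‖)]
  have he2 : ‖e‖ ^ 2 ≤ ρ ^ 2 := by gcongr
  have hN : 0 ≤ ‖g‖ ^ 2 + 2 * inner ℝ g e + ‖e‖ ^ 2 := by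
    rw [← norm_add_sq_real]; positivity
  have h5 : L / 2 * (η ^ 2 * (‖g‖ ^ 2 + 2 * inner ℝ g e + ‖e‖ ^ 2)) ≤
      η / 2 * (‖g‖ ^ 2 + 2 * inner ℝ g e + ‖e‖ ^ 2) := by
    have : L / 2 * (η ^ 2 * (‖g‖ ^ 2 + 2 * inner ℝ g e + ‖e‖ ^ 2)) =
      (η * L) * (η / 2 * (‖g‖ ^ 2 + 2 * inner ℝ g e + ‖e‖ ^ 2)) := by ring
    rw [this]
    exact mul_le_of_le_one_left (by positivity) hηL
  have h6 : η / 2 * (2 * τ * (f x - f p)) ≤ η / 2 * ‖g‖ ^ 2 :=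
    mul_le_mul_of_nonneg_left hPL (by positivity)
  have h7 : η / 2 * ‖e‖ ^ 2 ≤ η / 2 * ρ ^ 2 := mul_le_mul_of_nonneg_left he2 (by positivity)
  linarith

end Optimization

/-! ### Kernel derivatives, posterior variance and the surrogate error. -/

section Surrogate

/-- The base point moves with `s`, yet differentiability at `x` alone suffices: subtract the
difference quotients along `c + e` and `c`. -/
theorem tendsto_shifted_slope {F : Type*} [NormedAddCommGroup F] [NormedSpace ℝ F] {f : F → ℝ}
    {f' : F →L[ℝ] ℝ} {x : F} (hf : HasFDerivAt f f' x) (c e : F) :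
    Tendsto (fun s : ℝ => (f (x + s • c + s • e) - f (x + s • c)) / s) (𝓝[>] 0)
      (𝓝 (f' e)) := by
  have key : ∀ v : F, Tendsto (fun s : ℝ => s⁻¹ • (f (x + s • v) - f x)) (𝓝[>] 0) (𝓝 (f' v)) := by
    intro v
    exact (hf.hasLineDerivAt v).tendsto_slope_zero_right
  have h := (key (c + e)).sub (key c)
  rw [map_add, add_sub_cancel_left] at h
  refine h.congr fun s => ?_
  rw [smul_add, ← add_assoc, smul_eq_mul, smul_eq_mul]
  ring

/-- One use of l'Hôpital leaves a symmetric difference of `fderiv ℝ φ`. For a stationary kernel the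
numerator is the second difference `k u u - k u v - k v u + k v v`. -/
theorem tendsto_second_symmetric_difference {F : Type*} [NormedAddCommGroup F] [NormedSpace ℝ F]
    {φ : F → ℝ} (h1 : ∀ᶠ x in 𝓝 0, DifferentiableAt ℝ φ x)
    (h2 : DifferentiableAt ℝ (fderiv ℝ φ) 0) (e : F) :
    Tendsto (fun s : ℝ => (2 * φ 0 - φ (s • e) - φ (-(s • e))) / s ^ 2) (𝓝[>] 0)
      (𝓝 (-fderiv ℝ (fderiv ℝ φ) 0 e e)) := by
  have hs : Tendsto (fun s : ℝ => s • e) (𝓝[>] 0) (𝓝 0) := by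
    have : Continuous fun s : ℝ => s • e := by fun_prop
    simpa using (this.tendsto 0).mono_left nhdsWithin_le_nhds
  have hs' : Tendsto (fun s : ℝ => -(s • e)) (𝓝[>] 0) (𝓝 0) := by simpa using hs.neg
  have hφ : ContinuousAt φ 0 := h1.self_of_nhds.continuousAt
  have hder : ∀ᶠ s : ℝ in 𝓝[>] 0,
      HasDerivAt (fun s : ℝ => 2 * φ 0 - φ (s • e) - φ (-(s • e)))
        (-(fderiv ℝ φ (s • e) e) + fderiv ℝ φ (-(s • e)) e) s := by
    filter_upwards [hs.eventually h1, hs'.eventually h1] with s ha hb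
    have hl : HasDerivAt (fun s : ℝ => s • e) e s := by
      simpa using (hasDerivAt_id s).smul_const e
    have ha' := ha.hasFDerivAt.comp_hasDerivAt s hl
    have hb' := hb.hasFDerivAt.comp_hasDerivAt s hl.neg
    refine ((ha'.const_sub (2 * φ 0)).sub hb').congr_deriv ?_
    simp
  have hq : Tendsto (fun s : ℝ => (-(fderiv ℝ φ (s • e) e) + fderiv ℝ φ (-(s • e)) e) / (2 * s))
      (𝓝[>] 0) (𝓝 (-fderiv ℝ (fderiv ℝ φ) 0 e e)) := by
    have hd : HasFDerivAt (fun x => fderiv ℝ φ x e)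
        ((ContinuousLinearMap.apply ℝ ℝ e).comp (fderiv ℝ (fderiv ℝ φ) 0)) 0 :=
      (ContinuousLinearMap.apply ℝ ℝ e).hasFDerivAt.comp (0 : F) h2.hasFDerivAt
    have h := (tendsto_shifted_slope hd (-e) ((2 : ℝ) • e)).div_const (-2)
    have e1 : ((ContinuousLinearMap.apply ℝ ℝ e).comp (fderiv ℝ (fderiv ℝ φ) 0)) ((2 : ℝ) • e) / -2
        = -fderiv ℝ (fderiv ℝ φ) 0 e e := by
      simp
      ring
    rw [e1] at h
    refine h.congr fun s => ?_
    have e2 : (0 : F) + s • -e + s • (2 : ℝ) • e = s • e := by module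
    have e3 : (0 : F) + s • -e = -(s • e) := by module
    rw [e2, e3, div_div, ← neg_div_neg_eq]
    congr 1 <;> ring
  refine HasDerivAt.lhopital_zero_nhdsGT (g' := fun s => 2 * s) hder ?_ ?_ ?_ ?_ hq
  · refine Eventually.of_forall fun s => ?_
    simpa using hasDerivAt_pow 2 s
  · filter_upwards [self_mem_nhdsWithin] with s hs
    have : (0 : ℝ) < s := hs
    positivity
  · have h := ((tendsto_const_nhds (x := 2 * φ 0)).sub (hφ.tendsto.comp hs)).sub
      (hφ.tendsto.comp hs')
    have e0 : 2 * φ 0 - φ 0 - φ 0 = 0 := by ring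
    rw [e0] at h
    exact h
  · have : Continuous fun s : ℝ => s ^ 2 := by fun_prop
    simpa using (this.tendsto 0).mono_left nhdsWithin_le_nhds

/-- Positivity of `G` at `a - G⁻¹ b`. Any test vector `a` thus bounds the explained variance from
below, without computing an inverse. -/
theorem two_mul_dotProduct_sub_le {ι : Type*} [Fintype ι] [DecidableEq ι] {G : Matrix ι ι ℝ}
    (hG : G.PosDef) (a b : ι → ℝ) : 2 * (a ⬝ᵥ b) - a ⬝ᵥ (G *ᵥ a) ≤ b ⬝ᵥ (G⁻¹ *ᵥ b) := by
  set y := G⁻¹ *ᵥ b with hy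
  have hGy : G *ᵥ y = b := by
    rw [hy, Matrix.mulVec_mulVec, Matrix.mul_nonsing_inv _ ((Matrix.isUnit_iff_isUnit_det _).1 hG.isUnit), Matrix.one_mulVec]
  have hsymm : y ⬝ᵥ (G *ᵥ a) = a ⬝ᵥ b := by
    have hT : Gᵀ = G := by simpa using hG.isHermitian.eq
    rw [Matrix.dotProduct_mulVec, ← Matrix.mulVec_transpose, hT, hGy, dotProduct_comm]
  have h0 : 0 ≤ (a - y) ⬝ᵥ (G *ᵥ (a - y)) := by
    simpa using hG.posSemidef.dotProduct_mulVec_nonneg (a - y)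
  rw [Matrix.mulVec_sub, hGy, sub_dotProduct, dotProduct_sub, dotProduct_sub, hsymm,
    dotProduct_comm y b] at h0
  linarith

theorem gradient_apply {d : ℕ} {f : E d → ℝ} {θ : E d} (i : Fin d) :
    gradient f θ i = partialD i f θ := by
  have h : inner ℝ (gradient f θ) (EuclideanSpace.single i (1 : ℝ)) = partialD i f θ :=
    InnerProductSpace.toDual_symm_apply
  rw [← h, EuclideanSpace.inner_single_right]
  simp

variable {d : ℕ} {Θ : Set (E d)} {k : E d → E d → ℝ} {p θ : E d} {r : ℝ}

/-- The direction along which points of a ball around `p` are moved into the ball. -/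
noncomputable def inward (p θ : E d) (r : ℝ) : E d := r⁻¹ • (p - θ)

theorem add_smul_inward_mem (hr : 0 < r) (hθ : θ ∈ Metric.closedBall p r) {s : ℝ} (hs : 0 ≤ s)
    (hsr : s ≤ r) {e : E d} (he : ‖e‖ ≤ 1) :
    θ + s • inward p θ r + s • e ∈ Metric.closedBall p r := by
  have hq : p + r • e ∈ Metric.closedBall p r := by
    rw [mem_closedBall_iff_norm, add_sub_cancel_left, norm_smul, Real.norm_of_nonneg hr.le]
    exact mul_le_of_le_one_right hr.le he
  have h := (convex_closedBall p r).add_smul_sub_mem hθ hq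
    (t := s / r) ⟨by positivity, (div_le_one hr).2 hsr⟩
  convert h using 1
  rw [inward, add_assoc, smul_smul, div_eq_mul_inv, show p + r • e - θ = (p - θ) + r • e by abel,
    smul_add, smul_smul _ r, inv_mul_cancel_right₀ hr.ne']

/-- What the regularity of the kernel gives at a point `θ` of a ball contained in `Θ`, for the
points `θ + s • c` and `θ + s • c + s • e`, where `c` points into the ball and `e` is the `i`-th
basis vector. -/
structure KernelLimits (Θ : Set (E d)) (k : E d → E d → ℝ) (p θ : E d) (r : ℝ) (i : Fin d) :
    Prop where
  mixed_symm : ∀ v ∈ Θ, partialD i (fun u => k v u) θ = partialD i (fun u => k u v) θ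
  first : ∀ v ∈ Θ, Tendsto (fun s : ℝ =>
    (k (θ + s • inward p θ r + s • EuclideanSpace.single i 1) v - k (θ + s • inward p θ r) v) / s)
    (𝓝[>] 0) (𝓝 (partialD i (fun u => k u v) θ))
  cross : Tendsto (fun s : ℝ =>
    (partialD i (fun u => k u (θ + s • inward p θ r + s • EuclideanSpace.single i 1)) θ -
      partialD i (fun u => k u (θ + s • inward p θ r)) θ) / s)
    (𝓝[>] 0) (𝓝 (gradKerGrad k θ i i))
  second : Tendsto (fun s : ℝ =>
    (k (θ + s • inward p θ r + s • EuclideanSpace.single i 1)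
        (θ + s • inward p θ r + s • EuclideanSpace.single i 1) -
      k (θ + s • inward p θ r + s • EuclideanSpace.single i 1) (θ + s • inward p θ r) -
      k (θ + s • inward p θ r) (θ + s • inward p θ r + s • EuclideanSpace.single i 1) +
      k (θ + s • inward p θ r) (θ + s • inward p θ r)) / s ^ 2)
    (𝓝[>] 0) (𝓝 (gradKerGrad k θ i i))

theorem IsGoodKernel.symm (hk : IsGoodKernel Θ k) {u v : E d} (hu : u ∈ Θ) (hv : v ∈ Θ) :
    k u v = k v u := by
  classical
  have h := (hk.posDef {u, v} (by simp [insert_subset_iff, hu, hv])).isHermitian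
  have h2 := h.apply ⟨u, by simp⟩ ⟨v, by simp⟩
  simpa [gram] using h2.symm

theorem IsGoodKernel.kernelLimits (hk : IsGoodKernel Θ k) (hr : 0 < r)
    (hball : Metric.closedBall p r ⊆ Θ) (hθ : θ ∈ Metric.closedBall p r) (i : Fin d) :
    KernelLimits Θ k p θ r i := by
  obtain ⟨φ, U, hU, hsub, hφ, hkφ⟩ := hk.stationary_smooth
  set e : E d := EuclideanSpace.single i 1 with he
  have hθΘ : θ ∈ Θ := hball hθ
  have h0U : (0 : E d) ∈ U := by simpa using hsub θ hθΘ θ hθΘ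
  have hφat : ∀ x ∈ U, ContDiffAt ℝ 4 φ x := fun x hx => hφ.contDiffAt (hU.mem_nhds hx)
  have hφd : ∀ x ∈ U, DifferentiableAt ℝ φ x := fun x hx => (hφat x hx).differentiableAt (by simp)
  have hφ2 : DifferentiableAt ℝ (fderiv ℝ φ) 0 :=
    ((hφat 0 h0U).fderiv_right (m := 3) (by norm_num)).differentiableAt (by simp)
  have hleft : ∀ u v, u - v ∈ U → HasFDerivAt (fun u' => k u' v) (fderiv ℝ φ (u - v)) u := by
    intro u v huv
    have h := (hφd _ huv).hasFDerivAt.comp u ((hasFDerivAt_id u).sub_const v)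
    refine HasFDerivAt.congr_of_eventuallyEq (f := fun u' => φ (u' - v)) h ?_
    have hc : Continuous fun u' : E d => u' - v := by fun_prop
    filter_upwards [hc.continuousAt.preimage_mem_nhds (hU.mem_nhds huv)] with u' hu'
    exact hkφ _ _ hu'
  have hright : ∀ u v, u - v ∈ U → HasFDerivAt (fun v' => k u v') (-fderiv ℝ φ (u - v)) v := by
    intro u v huv
    have h := (hφd _ huv).hasFDerivAt.comp v ((hasFDerivAt_id v).const_sub u)
    refine HasFDerivAt.congr_of_eventuallyEq (f := fun v' => φ (u - v')) ?_ ?_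
    · refine h.congr_fderiv ?_
      ext w
      simp
    have hc : Continuous fun v' : E d => u - v' := by fun_prop
    filter_upwards [hc.continuousAt.preimage_mem_nhds (hU.mem_nhds huv)] with v' hv'
    exact hkφ _ _ hv'
  have happ : HasFDerivAt (fun x => fderiv ℝ φ x e)
      ((ContinuousLinearMap.apply ℝ ℝ e).comp (fderiv ℝ (fderiv ℝ φ) 0)) 0 :=
    (ContinuousLinearMap.apply ℝ ℝ e).hasFDerivAt.comp (0 : E d) hφ2.hasFDerivAt
  have hK : gradKerGrad k θ i i = -fderiv ℝ (fderiv ℝ φ) 0 e e := by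
    have hev : (fun u => partialD i (fun v => k u v) θ) =ᶠ[𝓝 θ]
        fun u => -(fderiv ℝ φ (u - θ) e) := by
      have hc : Continuous fun u' : E d => u' - θ := by fun_prop
      filter_upwards [hc.continuousAt.preimage_mem_nhds
        (hU.mem_nhds (by simpa using h0U : θ - θ ∈ U))] with u hu
      rw [partialD, (hright u θ hu).fderiv]
      rfl
    have hd : HasFDerivAt (fun u => -(fderiv ℝ φ (u - θ) e))
        (-((ContinuousLinearMap.apply ℝ ℝ e).comp (fderiv ℝ (fderiv ℝ φ) 0))) θ := by
      have h : HasFDerivAt (fun x => fderiv ℝ φ x e)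
          ((ContinuousLinearMap.apply ℝ ℝ e).comp (fderiv ℝ (fderiv ℝ φ) 0)) (θ - θ) := by
        rwa [sub_self]
      have h' := (HasFDerivAt.comp (f := fun u => u - θ) (g := fun x => fderiv ℝ φ x e) θ h
        ((hasFDerivAt_id θ).sub_const θ)).neg
      exact h'
    rw [gradKerGrad, Matrix.of_apply, partialD, hev.fderiv_eq, hd.fderiv]
    rfl
  have hen : ‖e‖ ≤ 1 := by simp [he]
  have hmem1 : ∀ s : ℝ, s ∈ Ioc 0 r → θ + s • inward p θ r + s • e ∈ Θ := fun s hs =>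
    hball (add_smul_inward_mem hr hθ hs.1.le hs.2 hen)
  have hmem0 : ∀ s : ℝ, s ∈ Ioc 0 r → θ + s • inward p θ r ∈ Θ := fun s hs => by
    simpa using hball (add_smul_inward_mem (e := 0) hr hθ hs.1.le hs.2 (by simp))
  have hIoc : ∀ᶠ s : ℝ in 𝓝[>] 0, s ∈ Ioc 0 r := Ioc_mem_nhdsGT hr
  refine ⟨fun v hv => ?_, fun v hv => ?_, ?_, ?_⟩
  -- Symmetry of `k` is known only on `Θ`; the ball has unique derivatives even at its boundary, so
  -- the two derivatives still agree.
  · have hu : UniqueDiffWithinAt ℝ (Metric.closedBall p r) θ :=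
      uniqueDiffOn_convex (convex_closedBall p r)
        ⟨p, Metric.ball_subset_interior_closedBall (Metric.mem_ball_self hr)⟩ θ hθ
    have h1 := (hright v θ (hsub v hv θ hθΘ)).hasFDerivWithinAt (s := Metric.closedBall p r)
    have h2 := (hleft θ v (hsub θ hθΘ v hv)).hasFDerivWithinAt (s := Metric.closedBall p r)
    have h3 := h1.congr (fun u hu => hk.symm (hball hu) hv) (hk.symm hθΘ hv)
    rw [partialD, partialD, (hright v θ (hsub v hv θ hθΘ)).fderiv,
      (hleft θ v (hsub θ hθΘ v hv)).fderiv, hu.eq h3 h2]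
  · have h := tendsto_shifted_slope (hleft θ v (hsub θ hθΘ v hv)) (inward p θ r) e
    rwa [partialD, (hleft θ v (hsub θ hθΘ v hv)).fderiv]
  · have h : HasFDerivAt (fun x => fderiv ℝ φ (θ - x) e)
        (-((ContinuousLinearMap.apply ℝ ℝ e).comp (fderiv ℝ (fderiv ℝ φ) 0))) θ := by
      have h : HasFDerivAt (fun x => fderiv ℝ φ x e)
          ((ContinuousLinearMap.apply ℝ ℝ e).comp (fderiv ℝ (fderiv ℝ φ) 0)) (θ - θ) := by
        rwa [sub_self]
      refine (HasFDerivAt.comp (g := fun x => fderiv ℝ φ x e) θ h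
        ((hasFDerivAt_id θ).const_sub θ)).congr_fderiv ?_
      ext w
      simp
    have h2 := tendsto_shifted_slope h (inward p θ r) e
    rw [hK]
    refine Tendsto.congr' ?_ h2
    filter_upwards [hIoc] with s hs
    rw [partialD, partialD, (hleft _ _ (hsub _ hθΘ _ (hmem1 s hs))).fderiv,
      (hleft _ _ (hsub _ hθΘ _ (hmem0 s hs))).fderiv]
  · rw [hK]
    have h := tendsto_second_symmetric_difference (eventually_of_mem (hU.mem_nhds h0U) hφd) hφ2 e
    refine Tendsto.congr' ?_ h
    filter_upwards [hIoc] with s hs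
    rw [hkφ _ _ (hsub _ (hmem1 s hs) _ (hmem1 s hs)), hkφ _ _ (hsub _ (hmem1 s hs) _ (hmem0 s hs)),
      hkφ _ _ (hsub _ (hmem0 s hs) _ (hmem1 s hs)), hkφ _ _ (hsub _ (hmem0 s hs) _ (hmem0 s hs))]
    simp only [sub_self, add_sub_cancel_left, sub_add_cancel_left]
    congr 1
    ring

theorem postGradCov_diag (hk : IsGoodKernel Θ k) (hr : 0 < r)
    (hball : Metric.closedBall p r ⊆ Θ) (hθ : θ ∈ Metric.closedBall p r)
    {D : Finset (E d)} (hD : (D : Set (E d)) ⊆ Θ) (i : Fin d) :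
    postGradCov k D θ i i =
      gradKerGrad k θ i i - gradKer k θ D i ⬝ᵥ ((gram k D)⁻¹ *ᵥ gradKer k θ D i) := by
  have hcol : (fun v => kerGrad k D θ v i) = gradKer k θ D i := by
    ext v
    exact (hk.kernelLimits hr hball hθ i).mixed_symm v (hD v.2)
  have hmul : (gradKer k θ D * ((gram k D)⁻¹ * kerGrad k D θ)) i i =
    gradKer k θ D i ⬝ᵥ ((gram k D)⁻¹ *ᵥ fun v => kerGrad k D θ v i) := rfl
  rw [postGradCov, Matrix.sub_apply, Matrix.mul_assoc, hmul, hcol]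

/-- Points close to `θ` in a suitable position make the posterior variance of a partial
derivative small. -/
theorem eventually_postGradCov_diag_le (hk : IsGoodKernel Θ k) (hr : 0 < r)
    (hball : Metric.closedBall p r ⊆ Θ) (hθ : θ ∈ Metric.closedBall p r) (i : Fin d)
    {ρ : ℝ} (hρ : 0 < ρ) :
    ∀ᶠ s : ℝ in 𝓝[>] 0, ∀ D : Finset (E d), (D : Set (E d)) ⊆ Θ →
      θ + s • inward p θ r + s • EuclideanSpace.single i 1 ∈ D → θ + s • inward p θ r ∈ D →
      postGradCov k D θ i i ≤ ρ := by
  have hl := hk.kernelLimits hr hball hθ i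
  have hlim := (hl.second.sub (hl.cross.const_mul 2)).const_add (gradKerGrad k θ i i)
  -- The limit is the variance of the derivative minus its difference quotient, which vanishes.
  have hlt : gradKerGrad k θ i i + (gradKerGrad k θ i i - 2 * gradKerGrad k θ i i) < ρ := by
    linarith
  filter_upwards [hlim.eventually (gt_mem_nhds hlt), self_mem_nhdsWithin] with s hs hs0 D hD hu hv
  have hs0' : (0 : ℝ) < s := hs0
  set u := θ + s • inward p θ r + s • EuclideanSpace.single i 1 with hudef
  set v := θ + s • inward p θ r with hvdef
  rw [postGradCov_diag hk hr hball hθ hD]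
  -- The test vector is the difference quotient `s⁻¹ (δ_u - δ_v)`.
  have hq := two_mul_dotProduct_sub_le (hk.posDef D hD)
    (s⁻¹ • (Pi.single ⟨u, hu⟩ 1 - Pi.single ⟨v, hv⟩ 1)) (gradKer k θ D i)
  have hG : ∀ a b : D, gram k D a b = k a b := fun _ _ => rfl
  have hK : ∀ a : D, gradKer k θ D i a = partialD i (fun u => k u a) θ := fun _ => rfl
  simp only [smul_dotProduct, sub_dotProduct, single_dotProduct, one_mul, Matrix.mulVec_smul,
    Matrix.mulVec_sub, Matrix.mulVec_single_one, dotProduct_smul, dotProduct_sub, smul_eq_mul,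
    hG, hK, Matrix.col_apply] at hq
  have e1 : (k u u - k u v - k v u + k v v) / s ^ 2 =
      s⁻¹ * (s⁻¹ * (k u u - k v u - (k u v - k v v))) := by
    field_simp
    ring
  rw [e1, div_eq_inv_mul] at hs
  linarith

theorem exists_acquisition_le (hk : IsGoodKernel Θ k) (hr : 0 < r)
    (hball : Metric.closedBall p r ⊆ Θ) (hθ : θ ∈ Metric.closedBall p r)
    {D : Finset (E d)} (hD : (D : Set (E d)) ⊆ Θ) {ε : ℝ} (hε : 0 < ε) :
    ∃ z : Finset (E d), (z : Set (E d)) ⊆ Θ ∧ 0 < z.card ∧ acquisition k D θ z ≤ ε := by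
  classical
  have hρ : 0 < ε / (d + 1) := by positivity
  have hex : ∀ i : Fin d, ∃ s : ℝ, s ∈ Ioc 0 r ∧ ∀ D : Finset (E d), (D : Set (E d)) ⊆ Θ →
      θ + s • inward p θ r + s • EuclideanSpace.single i 1 ∈ D → θ + s • inward p θ r ∈ D →
      postGradCov k D θ i i ≤ ε / (d + 1) := fun i =>
    (Eventually.and (Ioc_mem_nhdsGT hr) (eventually_postGradCov_diag_le hk hr hball hθ i hρ)).exists
  choose s hs hcov using hex
  -- Inserting `θ` keeps the batch nonempty when `d = 0`.
  set z : Finset (E d) := insert θ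
    (Finset.univ.image (fun i => θ + s i • inward p θ r + s i • EuclideanSpace.single i 1) ∪
      Finset.univ.image (fun i => θ + s i • inward p θ r)) with hz
  have hzΘ : (z : Set (E d)) ⊆ Θ := by
    intro y hy
    simp only [hz, Finset.coe_insert, Finset.coe_union, Finset.coe_image, Finset.coe_univ,
      image_univ, mem_insert_iff, mem_union, mem_range] at hy
    rcases hy with rfl | ⟨i, rfl⟩ | ⟨i, rfl⟩
    · exact hball hθ
    · exact hball (add_smul_inward_mem hr hθ (hs i).1.le (hs i).2 (by simp))
    · simpa using hball (add_smul_inward_mem (e := 0) hr hθ (hs i).1.le (hs i).2 (by simp))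
  refine ⟨z, hzΘ, Finset.card_pos.2 ⟨θ, by simp [hz]⟩, ?_⟩
  have hsum : acquisition k D θ z ≤ ∑ _i : Fin d, ε / (d + 1) := by
    rw [acquisition, Matrix.trace]
    refine Finset.sum_le_sum fun i _ => ?_
    have h := hcov i (D ∪ z) (by simp [hD, hzΘ])
      (Finset.mem_union_right _ (by simp [hz])) (Finset.mem_union_right _ (by simp [hz]))
    rw [Matrix.diag_apply]
    convert h
  refine hsum.trans ?_
  rw [Finset.sum_const, Finset.card_univ, Fintype.card_fin, nsmul_eq_mul, ← mul_div_assoc,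
    div_le_iff₀ (by positivity)]
  nlinarith

theorem exists_isBatch (hk : IsGoodKernel Θ k) (hr : 0 < r)
    (hball : Metric.closedBall p r ⊆ Θ) (hθ : θ ∈ Metric.closedBall p r)
    {D : Finset (E d)} (hD : (D : Set (E d)) ⊆ Θ) {ε : ℝ} (hε : 0 < ε) :
    ∃ z, IsBatch Θ k ε D θ z := by
  classical
  have hex : ∃ b : ℕ, ∃ z : Finset (E d), (z : Set (E d)) ⊆ Θ ∧ z.card = b ∧ 0 < b ∧
      acquisition k D θ z ≤ ε := by
    obtain ⟨z, h1, h2, h3⟩ := exists_acquisition_le hk hr hball hθ hD hε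
    exact ⟨z.card, z, h1, rfl, h2, h3⟩
  obtain ⟨z, hz1, hz2, hz3, hz4⟩ := Nat.find_spec hex
  have hmin : ∀ z' : Finset (E d), (z' : Set (E d)) ⊆ Θ → 0 < z'.card →
      acquisition k D θ z' ≤ ε → Nat.find hex ≤ z'.card := fun z' h1 h2 h3 =>
    Nat.find_min' hex ⟨z', h1, rfl, h2, h3⟩
  by_cases hatt : ∃ z₀ ∈ {z' : Finset (E d) | (z' : Set (E d)) ⊆ Θ ∧ z'.card = Nat.find hex},
      IsMinOn (acquisition k D θ) {z' | (z' : Set (E d)) ⊆ Θ ∧ z'.card = Nat.find hex} z₀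
  · obtain ⟨z₀, ⟨h1, h2⟩, h3⟩ := hatt
    exact ⟨z₀, h1, h2 ▸ hz3, (h3 ⟨hz1, hz2⟩).trans hz4, by rwa [h2], fun _ => by rwa [h2]⟩
  · exact ⟨z, hz1, hz2 ▸ hz3, hz4, by rwa [hz2], fun h => absurd h (by rwa [hz2])⟩

theorem MemRKHSBall.exists_featureMap {C : ℝ} {f : E d → ℝ} (hf : MemRKHSBall Θ k C f) :
    ∃ (H : Type) (_ : NormedAddCommGroup H) (_ : InnerProductSpace ℝ H) (Φ : E d → H) (g : H),
      (∀ u ∈ Θ, ∀ v ∈ Θ, inner ℝ (Φ u) (Φ v) = k u v) ∧ (∀ u ∈ Θ, inner ℝ (Φ u) g = f u) ∧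
      ‖g‖ ≤ C := by
  classical
  obtain ⟨H, hH1, hH2, _, _, hker, g, hg, hC⟩ := hf
  refine ⟨H, hH1, hH2, fun u => if h : u ∈ Θ then RKHS.kerFun H (⟨u, h⟩ : Θ) (1 : ℝ) else 0, g,
    fun u hu v hv => ?_, fun u hu => ?_, hC⟩
  · simp only [hu, hv, dif_pos]
    rw [real_inner_comm, ← RKHS.kernel_inner, ← hker ⟨u, hu⟩ ⟨v, hv⟩]
    simp
  · simp only [hu, dif_pos]
    rw [RKHS.kerFun_inner, ← hg ⟨u, hu⟩]
    simp

/-- Cauchy–Schwarz for the representer `s⁻¹ (Φ u - Φ v) - ∑ a w • Φ w`, then `s → 0`. Since `u` and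
`v` are shifted inward, both lie in `Θ`, even when `θ` is on the boundary of the ball. -/
theorem sq_partialD_sub_le (hk : IsGoodKernel Θ k) (hr : 0 < r)
    (hball : Metric.closedBall p r ⊆ Θ) (hθ : θ ∈ Metric.closedBall p r)
    {D : Finset (E d)} (hD : (D : Set (E d)) ⊆ Θ) {C : ℝ} {f : E d → ℝ}
    (hf : MemRKHSBall Θ k C f) (hfd : DifferentiableAt ℝ f θ) (i : Fin d) (a : D → ℝ) :
    (partialD i f θ - ∑ v, a v * f v) ^ 2 ≤
      C ^ 2 * (gradKerGrad k θ i i - 2 * (a ⬝ᵥ gradKer k θ D i) + a ⬝ᵥ (gram k D *ᵥ a)) := by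
  obtain ⟨H, _, _, Φ, g, hΦ, hΦg, hg⟩ := hf.exists_featureMap
  have hl := hk.kernelLimits hr hball hθ i
  have hlhs := ((tendsto_shifted_slope hfd.hasFDerivAt (inward p θ r)
    (EuclideanSpace.single i 1)).sub_const (∑ v, a v * f v)).pow 2
  have hfirst : Tendsto (fun s : ℝ => ∑ v : D, a v *
      ((k (θ + s • inward p θ r + s • EuclideanSpace.single i 1) v -
        k (θ + s • inward p θ r) v) / s)) (𝓝[>] 0) (𝓝 (a ⬝ᵥ gradKer k θ D i)) :=
    tendsto_finsetSum _ fun v _ => (hl.first v (hD v.2)).const_mul (a v)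
  have hrhs := ((hl.second.sub (hfirst.const_mul 2)).add_const
    (a ⬝ᵥ (gram k D *ᵥ a))).const_mul (C ^ 2)
  refine le_of_tendsto_of_tendsto hlhs hrhs ?_
  filter_upwards [Ioc_mem_nhdsGT hr] with s hs
  have huΘ : θ + s • inward p θ r + s • EuclideanSpace.single i 1 ∈ Θ :=
    hball (add_smul_inward_mem hr hθ hs.1.le hs.2 (by simp))
  have hvΘ : θ + s • inward p θ r ∈ Θ := by
    simpa using hball (add_smul_inward_mem (e := 0) hr hθ hs.1.le hs.2 (by simp))
  set u := θ + s • inward p θ r + s • EuclideanSpace.single i 1 with hudef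
  set v := θ + s • inward p θ r with hvdef
  set β : H := s⁻¹ • (Φ u - Φ v) - ∑ w : D, a w • Φ w with hβ
  have e1 : inner ℝ β g = (f u - f v) / s - ∑ w, a w * f w := by
    rw [hβ, inner_sub_left, sum_inner, inner_smul_left, inner_sub_left, hΦg u huΘ, hΦg v hvΘ]
    simp only [inner_smul_left, conj_trivial, hΦg _ (hD (Subtype.coe_prop _))]
    rw [div_eq_inv_mul]
  have e2 : ‖β‖ ^ 2 = (k u u - k u v - k v u + k v v) / s ^ 2 -
      2 * (∑ w : D, a w * ((k u w - k v w) / s)) + a ⬝ᵥ (gram k D *ᵥ a) := by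
    rw [hβ, norm_sub_sq_real, ← real_inner_self_eq_norm_sq, ← real_inner_self_eq_norm_sq]
    congr 1
    · congr 1
      · simp only [inner_smul_left, inner_smul_right, inner_sub_left, inner_sub_right,
          conj_trivial, hΦ u huΘ u huΘ, hΦ u huΘ v hvΘ, hΦ v hvΘ u huΘ, hΦ v hvΘ v hvΘ]
        field_simp
        ring
      · congr 1
        rw [inner_sum]
        refine Finset.sum_congr rfl fun w _ => ?_
        rw [inner_smul_right, inner_smul_left, inner_sub_left, hΦ u huΘ w (hD w.2),
          hΦ v hvΘ w (hD w.2), conj_trivial, div_eq_inv_mul]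
    · rw [sum_inner, dotProduct]
      refine Finset.sum_congr rfl fun w _ => ?_
      rw [inner_smul_left, inner_sum, conj_trivial, Matrix.mulVec, dotProduct]
      congr 1
      refine Finset.sum_congr rfl fun w' _ => ?_
      rw [inner_smul_right, hΦ w (hD w.2) w' (hD w'.2), gram, Matrix.of_apply, mul_comm]
  change ((f u - f v) / s - ∑ w, a w * f w) ^ 2 ≤ C ^ 2 *
    ((k u u - k u v - k v u + k v v) / s ^ 2 -
      2 * (∑ w : D, a w * ((k u w - k v w) / s)) + a ⬝ᵥ (gram k D *ᵥ a))
  rw [← e1, ← e2, ← mul_pow]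
  refine sq_le_sq' ?_ ?_
  · have h := (abs_le.1 (abs_real_inner_le_norm β g)).1
    nlinarith [norm_nonneg β]
  · have h := real_inner_le_norm β g
    nlinarith [norm_nonneg β]

/-- The squared error of the surrogate gradient is bounded by the squared norm of the function in
the reproducing kernel Hilbert space times the trace of the posterior gradient covariance. -/
theorem norm_gradient_sub_surrogateGrad_sq_le (hk : IsGoodKernel Θ k) (hr : 0 < r)
    (hball : Metric.closedBall p r ⊆ Θ) (hθ : θ ∈ Metric.closedBall p r)
    {D : Finset (E d)} (hD : (D : Set (E d)) ⊆ Θ) {C : ℝ} {f : E d → ℝ}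
    (hf : MemRKHSBall Θ k C f) (hfd : DifferentiableAt ℝ f θ) :
    ‖gradient f θ - surrogateGrad k D f θ‖ ^ 2 ≤ C ^ 2 * (postGradCov k D θ).trace := by
  rw [EuclideanSpace.real_norm_sq_eq, Matrix.trace, Finset.mul_sum]
  refine Finset.sum_le_sum fun i _ => ?_
  have hG := hk.posDef D hD
  -- With these weights the linear predictor is the surrogate derivative and the quadratic form
  -- collapses to the posterior variance.
  have h := sq_partialD_sub_le hk hr hball hθ hD hf hfd i ((gram k D)⁻¹ *ᵥ gradKer k θ D i)
  rw [Matrix.mulVec_mulVec, Matrix.mul_nonsing_inv _ ((Matrix.isUnit_iff_isUnit_det _).1 hG.isUnit), Matrix.one_mulVec,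
    dotProduct_comm _ (gradKer k θ D i)] at h
  rw [Matrix.diag_apply, postGradCov_diag hk hr hball hθ hD, PiLp.sub_apply, gradient_apply]
  have e1 : surrogateGrad k D f θ i = ∑ v, ((gram k D)⁻¹ *ᵥ gradKer k θ D i) v * f v := by
    change gradKer k θ D i ⬝ᵥ ((gram k D)⁻¹ *ᵥ fun u : D => f u) =
      ((gram k D)⁻¹ *ᵥ gradKer k θ D i) ⬝ᵥ fun u : D => f u
    have hT : ((gram k D)⁻¹)ᵀ = (gram k D)⁻¹ := by simpa using hG.inv.isHermitian.eq
    rw [Matrix.dotProduct_mulVec, ← Matrix.mulVec_transpose, hT]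
  rw [e1]
  refine h.trans_eq ?_
  ring

end Surrogate

/-! ### Tail bound for the Gaussian noise. -/

section Noise

theorem gaussianPDFReal_mul_exp_sq (x : ℝ) :
    gaussianPDFReal 0 1 x • Real.exp (x ^ 2 / 4) =
      (√(2 * Real.pi))⁻¹ * Real.exp (-(1 / 4) * x ^ 2) := by
  rw [gaussianPDFReal_def, smul_eq_mul, mul_assoc, ← Real.exp_add]
  simp only [NNReal.coe_one, mul_one, sub_zero]
  congr 2
  ring

theorem integral_exp_sq_gaussianReal :
    ∫ x, Real.exp (x ^ 2 / 4) ∂(gaussianReal 0 1) = √2 := by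
  rw [integral_gaussianReal_eq_integral_smul one_ne_zero]
  simp_rw [gaussianPDFReal_mul_exp_sq]
  rw [integral_const_mul, integral_gaussian, inv_mul_eq_div, ← Real.sqrt_div' _ (by positivity)]
  congr 1
  field_simp
  norm_num

theorem integrable_exp_sq_gaussianReal :
    Integrable (fun x => Real.exp (x ^ 2 / 4)) (gaussianReal 0 1) := by
  -- A non-integrable function has integral `0` by convention.
  refine Integrable.of_integral_ne_zero ?_
  rw [integral_exp_sq_gaussianReal]
  positivity

/-- Markov's inequality for `exp (‖w‖² / 4)`, whose mean is `√2 ^ d ≤ exp d`. -/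
theorem stdGaussian_norm_sq_tail {d : ℕ} (s : ℝ) :
    (stdGaussian (E d)).real {w | 4 * (d + s) ≤ ‖w‖ ^ 2} ≤ Real.exp (-s) := by
  have hprod : ∀ y : Fin d → ℝ, Real.exp (‖WithLp.toLp 2 y‖ ^ 2 / 4) =
      ∏ i, Real.exp (y i ^ 2 / 4) := by
    intro y
    rw [← Real.exp_sum, EuclideanSpace.real_norm_sq_eq, Finset.sum_div]
  have hmeas : MeasurableSet {w : E d | 4 * (d + s) ≤ ‖w‖ ^ 2} :=
    measurableSet_le measurable_const (by fun_prop)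
  rw [← map_pi_eq_stdGaussian, map_measureReal_apply (by fun_prop) hmeas]
  have hint : Integrable (fun y : Fin d → ℝ => ∏ i, Real.exp (y i ^ 2 / 4))
      (Measure.pi fun _ => gaussianReal 0 1) :=
    Integrable.fintype_prod fun _ => integrable_exp_sq_gaussianReal
  have hM := mul_meas_ge_le_integral_of_nonneg (ae_of_all _ fun y => Finset.prod_nonneg
    fun i _ => (Real.exp_pos _).le) hint (Real.exp (d + s))
  rw [integral_fintype_prod_eq_pow (fun x : ℝ => Real.exp (x ^ 2 / 4)),
    integral_exp_sq_gaussianReal, Fintype.card_fin] at hM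
  have hset : (WithLp.toLp 2 ⁻¹' {w : E d | 4 * (d + s) ≤ ‖w‖ ^ 2} : Set (Fin d → ℝ)) =
      {y | Real.exp (d + s) ≤ ∏ i, Real.exp (y i ^ 2 / 4)} := by
    ext y
    simp only [Set.mem_preimage, Set.mem_ofPred_eq, ← hprod, Real.exp_le_exp]
    constructor <;> intro h <;> linarith
  rw [hset]
  have h2 : √2 ^ d ≤ Real.exp d := by
    rw [← Real.exp_one_pow]
    gcongr
    rw [Real.sqrt_le_left (Real.exp_pos 1).le]
    nlinarith [Real.add_one_le_exp 1]
  set q := (Measure.pi fun _ => gaussianReal 0 1).real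
    {y : Fin d → ℝ | Real.exp (d + s) ≤ ∏ i, Real.exp (y i ^ 2 / 4)} with hq
  have h3 := hM.trans h2
  rw [Real.exp_add (d : ℝ) s, mul_assoc] at h3
  have h4 := (mul_le_iff_le_one_right (Real.exp_pos (d : ℝ))).1 h3
  rw [Real.exp_neg, ← one_div, le_div_iff₀ (Real.exp_pos s)]
  linarith

/-- With probability at least `1 - δ`, an almost sure event happens and all of `T` standard
Gaussian vectors are of norm at most `2 √(d + log (T / δ))`. -/
theorem exists_noise_event {d T : ℕ} {Ω : Type*} [MeasurableSpace Ω] {P : Measure Ω}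
    [IsProbabilityMeasure P] {w : ℕ → Ω → E d} {δ : ℝ} (hδ : 0 < δ)
    (hw : ∀ t < T, HasLaw (w t) (stdGaussian (E d)) P) {p : Ω → Prop} (hp : ∀ᵐ ω ∂P, p ω) :
    ∃ A : Set Ω, MeasurableSet A ∧ ENNReal.ofReal (1 - δ) ≤ P A ∧ ∀ ω ∈ A,
      p ω ∧ ∀ t < T, ‖w t ω‖ ≤ 2 * √(d + Real.log (T / δ)) := by
  set N : Set Ω := {ω | ¬ p ω} ∪
    ⋃ t ∈ Finset.range T, {ω | 4 * (d + Real.log (T / δ)) ≤ ‖w t ω‖ ^ 2} with hN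
  have hbad : ∀ t ∈ Finset.range T, P {ω | 4 * (d + Real.log (T / δ)) ≤ ‖w t ω‖ ^ 2} ≤
      ENNReal.ofReal (δ / T) := by
    intro t ht
    have htT := Finset.mem_range.1 ht
    have hT : (0 : ℝ) < T := by exact_mod_cast (Nat.zero_le t).trans_lt htT
    have hmeas : MeasurableSet {w : E d | 4 * (d + Real.log (T / δ)) ≤ ‖w‖ ^ 2} :=
      measurableSet_le measurable_const (by fun_prop)
    rw [(hw t htT).measure_eq hmeas, ← ofReal_measureReal]
    refine ENNReal.ofReal_le_ofReal ((stdGaussian_norm_sq_tail _).trans_eq ?_)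
    rw [Real.exp_neg, Real.exp_log (by positivity), inv_div]
  have hPN : P N ≤ ENNReal.ofReal δ := by
    have h1 : P {ω | ¬ p ω} = 0 := hp
    calc P N ≤ P {ω | ¬ p ω} + P (⋃ t ∈ Finset.range T,
          {ω | 4 * (d + Real.log (T / δ)) ≤ ‖w t ω‖ ^ 2}) := measure_union_le _ _
      _ ≤ 0 + ∑ t ∈ Finset.range T, P {ω | 4 * (d + Real.log (T / δ)) ≤ ‖w t ω‖ ^ 2} := by
          rw [h1]; gcongr; exact measure_biUnion_finset_le _ _
      _ ≤ ∑ t ∈ Finset.range T, ENNReal.ofReal (δ / T) := by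
          rw [zero_add]; exact Finset.sum_le_sum hbad
      _ ≤ ENNReal.ofReal δ := by
          rw [Finset.sum_const, Finset.card_range, ← ENNReal.ofReal_nsmul]
          refine ENNReal.ofReal_le_ofReal ?_
          rw [nsmul_eq_mul]
          rcases T.eq_zero_or_pos with h0 | h0
          · simp [h0, hδ.le]
          · have : (0 : ℝ) < T := by exact_mod_cast h0
            field_simp
            exact le_rfl
  -- The bad set need not be measurable, so its measurable hull is removed.
  refine ⟨(toMeasurable P N)ᶜ, (measurableSet_toMeasurable P N).compl, ?_, fun ω hω => ?_⟩
  · rw [prob_compl_eq_one_sub (measurableSet_toMeasurable P N), measure_toMeasurable,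
      ENNReal.ofReal_sub _ hδ.le, ENNReal.ofReal_one]
    gcongr
  · have hωN : ω ∉ N := fun h => hω (subset_toMeasurable P N h)
    simp only [hN, Set.mem_union, Set.mem_ofPred_eq, Set.mem_iUnion, Finset.mem_range, not_or,
      not_not, not_exists, not_le] at hωN
    refine ⟨hωN.1, fun t ht => ?_⟩
    have h := (hωN.2 t ht).le
    have h4 : 2 * √(d + Real.log (T / δ)) = √(4 * (d + Real.log (T / δ))) := by
      rw [Real.sqrt_mul (by norm_num), show (4 : ℝ) = 2 ^ 2 by norm_num,
        Real.sqrt_sq (by norm_num)]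
    rw [h4]
    exact Real.le_sqrt_of_sq_le h

end Noise

/-! ### Bias of the clipped gradient and the induction along a run. -/

section Convergence

/-- Clipping is the metric projection onto the ball of radius `B`, which contains `h`. -/
theorem norm_clip_sub_le {d : ℕ} {B : ℝ} {g h : E d} (hB : 0 < B) (hh : ‖h‖ ≤ B) :
    ‖clip B g - h‖ ≤ ‖g - h‖ := by
  rcases le_or_gt ‖g‖ B with hg | hg
  · rcases eq_or_ne g 0 with rfl | h0
    · simp [clip]
    · rw [clip, min_eq_left ((one_le_div (norm_pos_iff.2 h0)).2 hg), one_smul]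
  · have hg0 : 0 < ‖g‖ := hB.trans hg
    have hl1 : B / ‖g‖ ≤ 1 := (div_le_one hg0).2 hg.le
    have hlB : B / ‖g‖ * ‖g‖ = B := div_mul_cancel₀ _ hg0.ne'
    have hl0 : 0 ≤ B / ‖g‖ := by positivity
    rw [clip, min_eq_right hl1]
    set l := B / ‖g‖ with hl
    refine le_of_sq_le_sq ?_ (norm_nonneg _)
    rw [norm_sub_sq_real, norm_sub_sq_real, norm_smul, Real.norm_of_nonneg hl0, inner_smul_left,
      conj_trivial]
    have h1 : inner ℝ g h ≤ l * ‖g‖ * ‖g‖ := by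
      rw [hlB, mul_comm]
      exact (real_inner_le_norm g h).trans (by gcongr)
    have h2 := mul_le_mul_of_nonneg_left h1 (sub_nonneg.2 hl1)
    nlinarith [mul_nonneg (mul_nonneg (sub_nonneg.2 hl1) (sub_nonneg.2 hl1)) (sq_nonneg ‖g‖)]

theorem differentiableAt_objective {d n : ℕ} {X : Type*} {loss : E d → X → ℝ} {x : Fin n → X}
    {u : E d} (h : ∀ i, DifferentiableAt ℝ (fun v => loss v (x i)) u) :
    DifferentiableAt ℝ (objective loss x) u :=
  (DifferentiableAt.fun_sum fun i _ => h i).const_mul _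

theorem gradient_objective {d n : ℕ} {X : Type*} {loss : E d → X → ℝ} {x : Fin n → X}
    {u : E d} (h : ∀ i, DifferentiableAt ℝ (fun v => loss v (x i)) u) :
    gradient (objective loss x) u =
      (1 / (n : ℝ)) • ∑ i, gradient (fun v => loss v (x i)) u := by
  have h1 : HasFDerivAt (objective loss x)
      ((1 / (n : ℝ)) • ∑ i, fderiv ℝ (fun v => loss v (x i)) u) u :=
    (HasFDerivAt.fun_sum fun i _ => (h i).hasFDerivAt).const_mul _
  simp only [gradient, h1.fderiv, map_smulₛₗ, map_sum, conj_trivial]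

theorem evalSet_succ {d : ℕ} [DecidableEq (E d)] (z : ℕ → Finset (E d)) (t : ℕ) :
    evalSet z (t + 1) = evalSet z t ∪ z t := by
  ext u
  simp only [evalSet, Finset.mem_biUnion, Finset.mem_range, Finset.mem_union, Nat.lt_succ_iff_lt_or_eq]
  constructor
  · rintro ⟨s, hs | rfl, hu⟩
    · exact Or.inl ⟨s, hs, hu⟩
    · exact Or.inr hu
  · rintro (⟨s, hs, hu⟩ | hu)
    · exact ⟨s, Or.inl hs, hu⟩
    · exact ⟨t, Or.inr rfl, hu⟩

/-- The bias of the clipped surrogate gradient. -/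
theorem norm_clippedGrad_sub_gradient_le {d n : ℕ} {X : Type*} {Θ : Set (E d)}
    {k : E d → E d → ℝ} {loss : E d → X → ℝ} {x : Fin n → X} {p θ : E d} {r B C ε : ℝ}
    (hk : IsGoodKernel Θ k) (hr : 0 < r) (hB : 0 < B) (hC : 0 < C)
    (hball : Metric.closedBall p r ⊆ Θ) (hθ : θ ∈ Metric.closedBall p r)
    (hd : ∀ i, DifferentiableAt ℝ (fun v => loss v (x i)) θ)
    (hgB : ∀ i, ‖gradient (fun v => loss v (x i)) θ‖ ≤ B)
    (hH : ∀ i, MemRKHSBall Θ k C (fun v => loss v (x i)))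
    {D : Finset (E d)} (hD : (D : Set (E d)) ⊆ Θ) (htr : (postGradCov k D θ).trace ≤ ε) :
    ‖clippedGrad k loss x B D θ - gradient (objective loss x) θ‖ ≤ C * √ε := by
  have hi : ∀ i, ‖clip B (surrogateGrad k D (fun u => loss u (x i)) θ) -
      gradient (fun v => loss v (x i)) θ‖ ≤ C * √ε := by
    intro i
    refine (norm_clip_sub_le hB (hgB i)).trans ?_
    rw [norm_sub_rev]
    have h := norm_gradient_sub_surrogateGrad_sq_le hk hr hball hθ hD (hH i) (hd i)
    have h2 := Real.le_sqrt_of_sq_le (h.trans (mul_le_mul_of_nonneg_left htr (sq_nonneg C)))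
    rwa [Real.sqrt_mul (sq_nonneg C), Real.sqrt_sq hC.le] at h2
  rw [clippedGrad, gradient_objective hd, ← smul_sub, ← Finset.sum_sub_distrib, norm_smul,
    Real.norm_of_nonneg (by positivity)]
  calc 1 / (n : ℝ) * ‖∑ i, (clip B (surrogateGrad k D (fun u => loss u (x i)) θ) -
        gradient (fun v => loss v (x i)) θ)‖
      ≤ 1 / (n : ℝ) * ∑ _i : Fin n, C * √ε := by
        gcongr
        exact norm_sum_le_of_le _ fun i _ => hi i
    _ = (n / n : ℝ) * (C * √ε) := by
        rw [Finset.sum_const, Finset.card_univ, Fintype.card_fin, nsmul_eq_mul]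
        ring
    _ ≤ 1 * (C * √ε) := by
        gcongr
        exact div_self_le_one _
    _ = C * √ε := one_mul _

/-- A run of the algorithm in which every noise term is small stays in the ball, always finds a
batch, and decreases the suboptimality gap geometrically up to an additive error. -/
theorem IsRun.invariant {d n T : ℕ} {X : Type*} {Θ : Set (E d)} {k : E d → E d → ℝ}
    {loss : E d → X → ℝ} {x : Fin n → X} {θ₀ θs : E d} {τ r B L C ε η μ s : ℝ}
    {w θ : ℕ → E d} {z : ℕ → Finset (E d)}
    (hrun : IsRun Θ k loss x B ε η μ T θ₀ w θ z)
    (hτ : 0 < τ) (hr : 0 < r) (hB : 0 < B) (hL : 0 < L) (hC : 0 < C) (hε : 0 < ε) (hη : 0 < η)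
    (hd : ∀ i, ∀ u ∈ Θ, DifferentiableAt ℝ (fun v => loss v (x i)) u)
    (hLip : ∀ u ∈ Θ, ∀ v ∈ Θ,
      ‖gradient (objective loss x) u - gradient (objective loss x) v‖ ≤ L * ‖u - v‖)
    (hmin : IsLocallyStronglyConvexMin Θ (objective loss x) τ r θs) (hθ₀ : ‖θ₀ - θs‖ ≤ r)
    (hgB : ∀ i, ∀ u ∈ Θ, ‖gradient (fun v => loss v (x i)) u‖ ≤ B)
    (hk : IsGoodKernel Θ k) (hH : ∀ i, MemRKHSBall Θ k C (fun v => loss v (x i)))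
    (hηL : η * L ≤ 1) (hs : ∀ t < T, ‖(2 * B * √T / (n * μ)) • w t‖ ≤ s)
    (hsmall : C * √ε + s ≤ 3 / 4 * τ * r) {t : ℕ} (ht : t ≤ T) :
    (evalSet z t : Set (E d)) ⊆ Θ ∧ θ t ∈ Metric.closedBall θs r ∧
      objective loss x (θ t) - objective loss x θs ≤
        (1 - η * τ) ^ t * (objective loss x θ₀ - objective loss x θs) +
          (C * √ε + s) ^ 2 / (2 * τ) := by
  classical
  have hball := hmin.ball_subset
  have hdo : ∀ u ∈ Metric.closedBall θs r, DifferentiableAt ℝ (objective loss x) u := fun u hu =>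
    differentiableAt_objective fun i => hd i u (hball hu)
  have hgrad : gradient (objective loss x) θs = 0 := by
    have hloc : IsLocalMin (objective loss x) θs :=
      hmin.localMin.isLocalMin (Filter.mem_of_superset (Metric.closedBall_mem_nhds θs hr) hball)
    rw [gradient, hloc.fderiv_eq_zero, map_zero]
  induction t with
  | zero =>
    refine ⟨by simp [evalSet], ?_, ?_⟩
    · rw [hrun.init]
      exact mem_closedBall_iff_norm.2 hθ₀
    · rw [hrun.init, pow_zero, one_mul, le_add_iff_nonneg_right]
      positivity
  | succ t ih =>
    obtain ⟨hD, hθ, hF⟩ := ih (by omega)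
    have hbatch := hrun.batch t ht (exists_isBatch hk hr hball hθ hD hε)
    have hD' : (evalSet z (t + 1) : Set (E d)) ⊆ Θ := by
      rw [evalSet_succ, Finset.coe_union]
      exact Set.union_subset hD hbatch.subset
    refine ⟨hD', ?_⟩
    -- For `d = 0` there are no two points from which to deduce `τ ≤ L`, but all gaps vanish.
    rcases subsingleton_or_nontrivial (E d) with hsub | hnt
    · rw [Subsingleton.elim (θ (t + 1)) θs, Subsingleton.elim θ₀ θs]
      refine ⟨Metric.mem_closedBall_self hr.le, ?_⟩
      rw [sub_self, mul_zero, zero_add]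
      positivity
    have hτL : τ ≤ L := by
      obtain ⟨e, he⟩ := NormedSpace.exists_lt_norm ℝ (E d) 0 |>.imp fun e he => he
      set y := θs + (r / ‖e‖) • e with hy
      have hys : ‖y - θs‖ = r := by
        rw [hy, add_sub_cancel_left, norm_smul, Real.norm_of_nonneg (by positivity),
          div_mul_cancel₀ _ he.ne']
      have hyb : y ∈ Metric.closedBall θs r := mem_closedBall_iff_norm.2 hys.le
      have hsb := Metric.mem_closedBall_self (x := θs) hr.le
      have h1 := hmin.strongConvex y hyb θs hsb
      have h2 := real_inner_le_norm (gradient (objective loss x) y -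
        gradient (objective loss x) θs) (y - θs)
      have h3 := mul_le_mul_of_nonneg_right (hLip y (hball hyb) θs (hball hsb))
        (norm_nonneg (y - θs))
      rw [hys] at h1 h2 h3
      refine le_of_mul_le_mul_right (a := r ^ 2) ?_ (by positivity)
      linarith
    have htr : (postGradCov k (evalSet z (t + 1)) (θ t)).trace ≤ ε := by
      rw [evalSet_succ]
      convert hbatch.le_tol
      rw [acquisition]
    have hbias := norm_clippedGrad_sub_gradient_le hk hr hB hC hball hθ
      (fun i => hd i _ (hball hθ)) (fun i => hgB i _ (hball hθ)) hH hD' htr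
    set b := clippedGrad k loss x B (evalSet z (t + 1)) (θ t) -
      gradient (objective loss x) (θ t) with hb
    have hstep : θ (t + 1) = θ t - η • (gradient (objective loss x) (θ t) +
        (b + (2 * B * √T / (n * μ)) • w t)) := by
      rw [hrun.step t ht, hb]
      congr 2
      abel
    have he := (norm_add_le b ((2 * B * √T / (n * μ)) • w t)).trans (add_le_add hbias (hs t ht))
    have hmain := inexact_gradStep (τ' := 3 / 4 * τ) hr hdo
      (fun u hu v hv => hLip u (hball hu) v (hball hv)) hmin.strongConvex hτ (by linarith) hτL hη
      hηL hgrad hθ he hsmall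
    rw [← hstep] at hmain
    refine ⟨hmain.1, hmain.2.trans ?_⟩
    have hκ : 0 ≤ 1 - η * τ := by nlinarith
    have h4 := mul_le_mul_of_nonneg_left hF hκ
    -- The additive term is the fixed point of `a ↦ (1 - ητ) a + (η/2)(C √ε + s)²`.
    have h5 : (1 - η * τ) * ((1 - η * τ) ^ t * (objective loss x θ₀ - objective loss x θs) +
        (C * √ε + s) ^ 2 / (2 * τ)) + η / 2 * (C * √ε + s) ^ 2 =
        (1 - η * τ) ^ (t + 1) * (objective loss x θ₀ - objective loss x θs) +
          (C * √ε + s) ^ 2 / (2 * τ) := by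
      field_simp
      ring
    linarith

end Convergence

end DPGIBO

theorem mainTheorem2 (τ r B : ℝ) (hτ : 0 < τ) (hr : 0 < r) (hB : 0 < B) :
    -- the constants hidden in `Ω` and `O` depend on `τ`, `r` and `B` only
    ∃ c₁ c₂ : ℝ, 0 < c₁ ∧ 0 < c₂ ∧
      ∀ (d n T : ℕ) (Ω : Type*) (_ : MeasurableSpace Ω) (P : Measure Ω) (_ : IsProbabilityMeasure P)
        (X : Type*) (x : Fin n → X)
        (Θ : Set (DPGIBO.E d)) (k : DPGIBO.E d → DPGIBO.E d → ℝ) (loss : DPGIBO.E d → X → ℝ)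
        (θ₀ θs : DPGIBO.E d) (L C ε η μ δ : ℝ)
        (w θ : ℕ → Ω → DPGIBO.E d) (z : ℕ → Ω → Finset (DPGIBO.E d)),
      IsCompact Θ → θ₀ ∈ Θ →
      0 < L → 0 < C → 0 < ε → 0 < η → 0 < μ → 0 < δ → δ < 1 →
      -- the losses are differentiable on `Θ`, and `f_x` is `L`-smooth
      (∀ i, ∀ u ∈ Θ, DifferentiableAt ℝ (fun v => loss v (x i)) u) →
      (∀ u ∈ Θ, ∀ v ∈ Θ, ‖gradient (DPGIBO.objective loss x) u -
        gradient (DPGIBO.objective loss x) v‖ ≤ L * ‖u - v‖) →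
      -- a local minimum within distance `r` of the start, with local strong convexity
      DPGIBO.IsLocallyStronglyConvexMin Θ (DPGIBO.objective loss x) τ r θs →
      ‖θ₀ - θs‖ ≤ r →
      -- bounded gradients of the individual losses
      (∀ i, ∀ u ∈ Θ, ‖gradient (fun v => loss v (x i)) u‖ ≤ B) →
      -- the kernel, and the losses in its RKHS
      DPGIBO.IsGoodKernel Θ k →
      (∀ i, DPGIBO.MemRKHSBall Θ k C (fun v => loss v (x i))) →
      -- the conditions on the tolerance, the sample size and the step size
      ε ≤ τ ^ 2 * r ^ 2 / (4 * C ^ 2) →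
      c₁ * (√(T * (d + Real.log (T / δ))) / μ) ≤ n →
      η ≤ 1 / L →
      -- independent standard Gaussian privacy noise, and a run of the algorithm
      iIndepFun (fun t : Fin T => w t) P →
      (∀ t < T, HasLaw (w t) (stdGaussian (DPGIBO.E d)) P) →
      (∀ᵐ ω ∂P, DPGIBO.IsRun Θ k loss x B ε η μ T θ₀
        (fun t => w t ω) (fun t => θ t ω) (fun t => z t ω)) →
      -- with probability at least `1 - δ`, the iterates stay in `Θ`, no step lacks a batch,
      -- and the suboptimality gap is bounded
      ∃ A : Set Ω, MeasurableSet A ∧ ENNReal.ofReal (1 - δ) ≤ P A ∧ ∀ ω ∈ A,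
        (∀ t ≤ T, θ t ω ∈ Θ) ∧
        (∀ t < T, DPGIBO.IsBatch Θ k ε (DPGIBO.evalSet (fun s => z s ω) t) (θ t ω) (z t ω)) ∧
        DPGIBO.objective loss x (θ T ω) - DPGIBO.objective loss x θs ≤
          (1 - η * τ) ^ T * (DPGIBO.objective loss x θ₀ - DPGIBO.objective loss x θs) +
          ε * C ^ 2 / (2 * τ) +
          (c₂ * (√(T * (d + Real.log (T / δ))) / (n * μ))) / τ := by
  classical
  -- With noise bound `s = 4BQ/(nμ)`, the first constant gives `s ≤ τr/4`; with `C √ε ≤ τr/2` the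
  -- total error is at most `(3/4) τ r`. The second comes from `(C √ε + s)² ≤ ε C² + (5/4) τ r s`,
  -- divided by `2τ`.
  refine ⟨16 * B / (τ * r), 5 / 2 * r * τ * B, by positivity, by positivity, ?_⟩
  intro d n T Ω _ P _ X x Θ k loss θ₀ θs L C ε η μ δ w θ z _ _ hL hC hε hη hμ hδ _ hd hLip hmin
    hθ₀ hgB hk hH hεle hn hηle _ hw hrun
  have hηL : η * L ≤ 1 := (le_div_iff₀ hL).1 hηle
  obtain ⟨A, hA, hPA, hgood⟩ := DPGIBO.exists_noise_event hδ hw hrun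
  refine ⟨A, hA, hPA, fun ω hω => ?_⟩
  obtain ⟨hrunω, hnorm⟩ := hgood ω hω
  set Q := √(T * (d + Real.log (T / δ))) with hQ
  have hQ0 : 0 ≤ Q := Real.sqrt_nonneg _
  set s := 4 * B * (Q / (n * μ)) with hs
  have hs0 : 0 ≤ s := by positivity
  have hnoise : ∀ t < T, ‖(2 * B * √T / (n * μ)) • w t ω‖ ≤ s := by
    intro t ht
    rw [norm_smul, Real.norm_of_nonneg (by positivity)]
    calc 2 * B * √T / (n * μ) * ‖w t ω‖
        ≤ 2 * B * √T / (n * μ) * (2 * √(d + Real.log (T / δ))) := by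
          gcongr
          exact hnorm t ht
      _ = s := by
          rw [hs, hQ, Real.sqrt_mul (Nat.cast_nonneg T)]
          ring
  have hsle : s ≤ τ * r / 4 := by
    -- For `n = 0` division by zero makes `s = 0`.
    rcases n.eq_zero_or_pos with h0 | h0
    · rw [hs, h0]
      simp only [Nat.cast_zero, zero_mul, div_zero, mul_zero]
      positivity
    · have hn0 : (0 : ℝ) < n := by exact_mod_cast h0
      have h1 : 16 * B * Q ≤ n * (τ * r * μ) := by
        rw [div_mul_div_comm, div_le_iff₀ (by positivity)] at hn
        exact hn
      rw [hs, ← mul_div_assoc, div_le_iff₀ (by positivity)]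
      linarith
  have hCε : C * √ε ≤ τ * r / 2 := by
    have h1 : ε ≤ (τ * r / (2 * C)) ^ 2 := by
      refine hεle.trans_eq ?_
      field_simp
      norm_num
    have h2 := Real.sqrt_le_iff.2 ⟨by positivity, h1⟩
    rw [le_div_iff₀ (by positivity)] at h2
    linarith
  have hinv := fun t (ht : t ≤ T) => hrunω.invariant hτ hr hB hL hC hε hη hd hLip hmin hθ₀ hgB hk hH
    hηL hnoise (by linarith) ht
  refine ⟨fun t ht => hmin.ball_subset (hinv t ht).2.1, fun t ht => ?_, ?_⟩
  · exact hrunω.batch t ht (DPGIBO.exists_isBatch hk hr hmin.ball_subset (hinv t ht.le).2.1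
      (hinv t ht.le).1 hε)
  · refine (hinv T le_rfl).2.2.trans ?_
    rw [add_assoc]
    gcongr
    rw [← sub_nonneg]
    have h1 : (C * √ε + s) ^ 2 ≤ ε * C ^ 2 + 5 / 4 * τ * r * s := by
      have h2 : (C * √ε) ^ 2 = ε * C ^ 2 := by rw [mul_pow, Real.sq_sqrt hε.le, mul_comm]
      nlinarith [mul_le_mul_of_nonneg_right hCε hs0, mul_le_mul_of_nonneg_right hsle hs0]
    have h3 : ε * C ^ 2 / (2 * τ) + 5 / 2 * r * τ * B * (Q / (n * μ)) / τ =
        (ε * C ^ 2 + 5 / 4 * τ * r * s) / (2 * τ) := by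
      rw [hs]
      field_simp
    rw [h3, sub_nonneg]
    gcongr
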